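/- Let $N\ge 2$, $1<p<N$, $p^*=\frac{pN}{N-p}$, let $\Omega\subset\mathbb R^N$ be a bounded open set with Lipschitz boundary, $\Omega^e=\mathbb R^N\setminus\overline\Omega$, and let $F$ be any norm on $\mathbb R^N$, with subdifferential $\partial F(\xi)=\{\delta: F(\eta)-F(\xi)\ge\delta\cdot(\eta-\xi)\ \forall\eta\in\mathbb R^N\}$. Let $\varphi_1,\varphi_2\in W^{1-\frac1p,p}(\partial\Omega)$ with $\varphi_1\le\varphi_2$ $\mathcal H^{N-1}$-a.e. on $\partial\Omega$. For $i=1,2$ let $u_i\in L^{p^*}(\Omega^e)$ have weak gradient $\nabla u_i\in L^p(\Omega^e;\mathbb R^N)$ and trace $\varphi_i$ on $\partial\Omega$, with $u_i(x)\to0$ as $|x|\to\infty$ (in the essential sense), and let $\mathbf z_i:\Omega^e\to\mathbb R^N$ be measurable with $\mathbf z_i(x)\in\partial F(\nabla u_i(x))$ for a.e. $x\in\Omega^e$. Suppose that $u_1$ is a weak subsolution and $u_2$ a weak supersolution of the anisotropic $p$-Laplace equation, i.e. $$\operatorname{div}\big(F^{p-1}(\nabla u_2)\,\mathbf z_2\big)\le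 0\le\operatorname{div}\big(F^{p-1}(\nabla u_1)\,\mathbf z_1\big)\quad\text{weakly in }\Omega^e,$$ which means that, for every $w\in W^{1,p}_0(\Omega^e)$ with $w\ge0$ a.e., $$\int_{\Omega^e}F^{p-1}(\nabla u_1)\,\mathbf z_1\cdot\nabla w\,dx\le 0\le\int_{\Omega^e}F^{p-1}(\nabla u_2)\,\mathbf z_2\cdot\nabla w\,dx .$$ Then $u_1\le u_2$ a.e. in $\Omega^e$. -/

import Mathlib

open MeasureTheory Set Filter Topology
open scoped ContDiff RealInnerProductSpace

noncomputable section

/-- The space `ℝᴺ` with its Euclidean norm and inner product. -/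
abbrev Euc (N : ℕ) : Type := EuclideanSpace ℝ (Fin N)

/-- The exterior domain `Ωᵉ`, the complement of the closure of `Ω`. -/
def extDomain {N : ℕ} (Ω : Set (Euc N)) : Set (Euc N) := (closure Ω)ᶜ

/-- `Ω` has Lipschitz boundary: near each boundary point, after a choice of a unit vector `e`
(the vertical direction), `Ω` is the strict epigraph of a Lipschitz function `γ` of the
horizontal component `y - ⟪e, y⟫ e`. -/
def HasLipschitzBoundary {N : ℕ} (Ω : Set (Euc N)) : Prop :=
  ∀ x ∈ frontier Ω, ∃ (e : Euc N) (γ : Euc N → ℝ) (K : NNReal) (r : ℝ),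
    ‖e‖ = 1 ∧ LipschitzWith K γ ∧ 0 < r ∧
      ∀ y ∈ Metric.ball x r, (y ∈ Ω ↔ γ (y - ⟪e, y⟫ • e) < ⟪e, y⟫)

/-- The surface measure on `∂Ω`: the `(N-1)`-dimensional Hausdorff measure restricted to `∂Ω`. -/
def surfaceMeasure {N : ℕ} (Ω : Set (Euc N)) : Measure (Euc N) :=
  (Measure.hausdorffMeasure ((N : ℝ) - 1)).restrict (frontier Ω)

/-- The subdifferential of `Φ` at `ξ`. -/
def subdiff {N : ℕ} (Φ : Euc N → ℝ) (ξ : Euc N) : Set (Euc N) :=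
  {δ | ∀ η : Euc N, ⟪δ, η - ξ⟫ ≤ Φ η - Φ ξ}

/-- `G` is the weak (distributional) gradient of `u` on the open set `U`. -/
structure HasWeakGradient {N : ℕ} (U : Set (Euc N)) (u : Euc N → ℝ) (G : Euc N → Euc N) :
    Prop where
  locInt : LocallyIntegrableOn u U volume
  grad_locInt : LocallyIntegrableOn G U volume
  integral_eq : ∀ ψ : Euc N → ℝ, ContDiff ℝ ∞ ψ → HasCompactSupport ψ → tsupport ψ ⊆ U →
    ∫ x in U, u x • gradient ψ x = - ∫ x in U, ψ x • G x

/-- `w` belongs to `W₀^{1,p}(U)`, the closure of `C_c^∞(U)` in `W^{1,p}(U)`, and its weak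
gradient is `G`. -/
structure MemW1pZero {N : ℕ} (p : ℝ) (U : Set (Euc N)) (w : Euc N → ℝ) (G : Euc N → Euc N) :
    Prop where
  memLp : MemLp w (ENNReal.ofReal p) (volume.restrict U)
  hasWeakGradient : HasWeakGradient U w G
  grad_memLp : MemLp G (ENNReal.ofReal p) (volume.restrict U)
  approx : ∃ ψ : ℕ → Euc N → ℝ,
    (∀ k, ContDiff ℝ ∞ (ψ k) ∧ HasCompactSupport (ψ k) ∧ tsupport (ψ k) ⊆ U) ∧
    Tendsto (fun k => eLpNorm (fun x => ψ k x - w x) (ENNReal.ofReal p) (volume.restrict U))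
      atTop (𝓝 0) ∧
    Tendsto (fun k => eLpNorm (fun x => gradient (ψ k) x - G x) (ENNReal.ofReal p)
      (volume.restrict U)) atTop (𝓝 0)

/-- The fractional Sobolev space `W^{1-1/p,p}(∂Ω)`: functions in `L^p(∂Ω)` with finite Gagliardo
seminorm. The exponent of `|x - y|` is `(N-1) + (1-1/p) p = N + p - 2`. -/
structure MemTraceSpace {N : ℕ} (p : ℝ) (Ω : Set (Euc N)) (φ : Euc N → ℝ) : Prop where
  memLp : MemLp φ (ENNReal.ofReal p) (surfaceMeasure Ω)
  seminorm_lt_top :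
    ∫⁻ x, ∫⁻ y, ‖φ x - φ y‖ₑ ^ p / edist x y ^ ((N : ℝ) + p - 2)
      ∂(surfaceMeasure Ω) ∂(surfaceMeasure Ω) < ⊤

/-- The function `u` on `Ωᵉ`, with weak gradient `G`, has trace `φ` on `∂Ω`: it is the limit, in
`W^{1,p}` of every bounded part of `Ωᵉ`, of smooth functions on `ℝᴺ` whose restrictions to `∂Ω`
converge to `φ` in `L^p(∂Ω)`. (The trace operator is the continuous extension of the
restriction of smooth functions to the boundary.) -/
def HasTrace {N : ℕ} (p : ℝ) (Ω : Set (Euc N)) (u : Euc N → ℝ) (G : Euc N → Euc N)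
    (φ : Euc N → ℝ) : Prop :=
  ∃ w : ℕ → Euc N → ℝ, (∀ k, ContDiff ℝ ∞ (w k)) ∧
    (∀ R : ℝ, Tendsto (fun k => eLpNorm (fun x => w k x - u x) (ENNReal.ofReal p)
      (volume.restrict (extDomain Ω ∩ Metric.ball 0 R))) atTop (𝓝 0)) ∧
    (∀ R : ℝ, Tendsto (fun k => eLpNorm (fun x => gradient (w k) x - G x) (ENNReal.ofReal p)
      (volume.restrict (extDomain Ω ∩ Metric.ball 0 R))) atTop (𝓝 0)) ∧
    Tendsto (fun k => eLpNorm (fun x => w k x - φ x) (ENNReal.ofReal p) (surfaceMeasure Ω))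
      atTop (𝓝 0)

/-- `u(x) → 0` as `|x| → ∞` in `Ωᵉ`, for a function defined up to null sets. -/
def VanishesAtInfinity {N : ℕ} (Ω : Set (Euc N)) (u : Euc N → ℝ) : Prop :=
  ∀ ε : ℝ, 0 < ε → ∃ R : ℝ, ∀ᵐ x ∂(volume.restrict (extDomain Ω)), R < ‖x‖ → |u x| < ε

/-- The conditions common to weak sub- and supersolutions with boundary values `φ`:
`u ∈ L^{p*}(Ωᵉ)` with `p* = pN/(N-p)`, its weak gradient `G` is in `L^p(Ωᵉ)`, its trace is `φ`,
`u` vanishes at infinity, and `z` is a measurable selection of `∂F(∇u)`. -/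
structure IsAdmissible {N : ℕ} (F : Seminorm ℝ (Euc N)) (p : ℝ) (Ω : Set (Euc N))
    (φ u : Euc N → ℝ) (G z : Euc N → Euc N) : Prop where
  memLp : MemLp u (ENNReal.ofReal (p * N / (N - p))) (volume.restrict (extDomain Ω))
  hasWeakGradient : HasWeakGradient (extDomain Ω) u G
  grad_memLp : MemLp G (ENNReal.ofReal p) (volume.restrict (extDomain Ω))
  hasTrace : HasTrace p Ω u G φ
  vanishes : VanishesAtInfinity Ω u
  z_measurable : AEStronglyMeasurable z (volume.restrict (extDomain Ω))
  z_mem : ∀ᵐ x ∂(volume.restrict (extDomain Ω)), z x ∈ subdiff F (G x)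

/-- `u` is a weak subsolution, with boundary values `φ`: for some `z ∈ ∂F(∇u)`,
`0 ≤ div (F^{p-1}(∇u) z)` in `Ωᵉ`, tested with the non-negative functions of `W₀^{1,p}(Ωᵉ)`. -/
def IsWeakSubsolution {N : ℕ} (F : Seminorm ℝ (Euc N)) (p : ℝ) (Ω : Set (Euc N))
    (φ u : Euc N → ℝ) : Prop :=
  ∃ G z : Euc N → Euc N, IsAdmissible F p Ω φ u G z ∧
    ∀ (w : Euc N → ℝ) (H : Euc N → Euc N), MemW1pZero p (extDomain Ω) w H →
      (∀ᵐ x ∂(volume.restrict (extDomain Ω)), 0 ≤ w x) →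
      ∫ x in extDomain Ω, F (G x) ^ (p - 1) * ⟪z x, H x⟫ ≤ 0

/-- `u` is a weak supersolution, with boundary values `φ`: for some `z ∈ ∂F(∇u)`,
`div (F^{p-1}(∇u) z) ≤ 0` in `Ωᵉ`, tested with the non-negative functions of `W₀^{1,p}(Ωᵉ)`. -/
def IsWeakSupersolution {N : ℕ} (F : Seminorm ℝ (Euc N)) (p : ℝ) (Ω : Set (Euc N))
    (φ u : Euc N → ℝ) : Prop :=
  ∃ G z : Euc N → Euc N, IsAdmissible F p Ω φ u G z ∧
    ∀ (w : Euc N → ℝ) (H : Euc N → Euc N), MemW1pZero p (extDomain Ω) w H →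
      (∀ᵐ x ∂(volume.restrict (extDomain Ω)), 0 ≤ w x) →
      0 ≤ ∫ x in extDomain Ω, F (G x) ^ (p - 1) * ⟪z x, H x⟫

end

open scoped ENNReal Pointwise

noncomputable section

/-! The norm `F` need not be strictly convex, so comparing the two fluxes does not by itself
identify the gradients, and a second test function is needed. Let `β` be smooth, zero on `(-∞, ε]`
and increasing beyond. Testing both inequalities with `β(u₁ - u₂)` and subtracting gives the
integral of `β'(u₁ - u₂)` times a monotonicity expression that is pointwise nonnegative; hence it
vanishes. The equality case (`rpow_mul_inner_sub_nonneg`) yields, on `{u₁ - u₂ > ε}`, only `F(∇u₁) =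
F(∇u₂)` and `F(∇u₁)^(p-1) z₁·(∇u₁ - ∇u₂) = 0`. Testing the subsolution alone with `β(u₁ - u₂)
g(u₁)`, where `g` and `g'` are positive, the term in `∇u₁ - ∇u₂` drops out by this identity, and
`z₁·∇u₁ = F(∇u₁)` leaves the integral of `β g' F(∇u₁)^p`, which is therefore zero. So both gradients
vanish on `{u₁ - u₂ > ε}`, the function `β(u₁ - u₂)` of `W₀^{1,p}` has zero gradient, and Sobolev's
inequality makes it zero. Then `ε → 0`.

Most of the work is the admissibility of these test functions (`memW1pZero_testFun`). Decay at
infinity and the margin `ε` make them vanish outside a ball. Composing with the smooth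
approximations that define the traces gives smooth functions whose boundary values tend to zero in
`L^p(∂Ω)`. It remains to approximate their limit by functions compactly supported in the exterior
domain (`smoothCompactApprox_of_trace_tendsto_zero`). A partition of unity localises to one
Lipschitz graph. There a Gauss formula along directions transversal to the graph
(`exists_integral_fderiv_le_surface`) shows that extension by zero preserves weak differentiability,
and mollification with a kernel shifted away from `Ω` moves the support into the exterior domain. -/

/-! ### Gauss' formula along directions transversal to a graph -/

/-- Orthogonal coordinates `ℝᴺ = ℝⁿ × ℝ d` adapted to a unit vector `d`. -/
theorem exists_orthogonal_coordinates {n : ℕ} {d : Euc (n + 1)} (hd : ‖d‖ = 1) :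
    ∃ (L : (Fin n → ℝ) →L[ℝ] Euc (n + 1)) (P : Euc (n + 1) →L[ℝ] (Fin n → ℝ)),
      LipschitzWith 1 P ∧ (∀ y (s : ℝ), P (L y + s • d) = y) ∧
      (Function.Injective fun z : ℝ × (Fin n → ℝ) => L z.2 + z.1 • d) ∧
      MeasurePreserving (fun z : ℝ × (Fin n → ℝ) => L z.2 + z.1 • d) volume volume := by
  classical
  have hv : Orthonormal ℝ (({0} : Set (Fin (n + 1))).domRestrict (fun _ => d)) := by
    rw [orthonormal_iff_ite]
    rintro ⟨i, hi⟩ ⟨j, hj⟩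
    simp only [mem_singleton_iff] at hi hj
    subst hi; subst hj
    simp [hd]
  obtain ⟨b, hb⟩ := hv.exists_orthonormalBasis_extension_of_card_eq (by simp)
  have hb0 : b 0 = d := hb 0 rfl
  let L : (Fin n → ℝ) →L[ℝ] Euc (n + 1) :=
    ∑ j : Fin n, (ContinuousLinearMap.proj (R := ℝ) (φ := fun _ : Fin n => ℝ) j).smulRight (b j.succ)
  let P : Euc (n + 1) →L[ℝ] (Fin n → ℝ) :=
    ContinuousLinearMap.pi fun j => innerSL ℝ (b j.succ)
  have hL : ∀ y, L y = ∑ j, y j • b j.succ := fun y => by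
    simp [L]
  have hΦ : ∀ z : ℝ × (Fin n → ℝ), L z.2 + z.1 • d =
      b.repr.symm (WithLp.toLp 2 ((MeasurableEquiv.piFinSuccAbove (fun _ => ℝ) 0).symm z)) := by
    rintro ⟨s, y⟩
    rw [← b.sum_repr (b.repr.symm _), Fin.sum_univ_succ, hL, add_comm (Finset.sum _ _)]
    simp [hb0, MeasurableEquiv.piFinSuccAbove]
  have hP : ∀ y (s : ℝ), P (L y + s • d) = y := by
    intro y s
    ext j
    rw [show P (L y + s • d) j = b.repr (L y + s • d) j.succ by
      rw [b.repr_apply_apply]; rfl,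
      hΦ (s, y)]
    simp [MeasurableEquiv.piFinSuccAbove]
  refine ⟨L, P, ?_, hP, ?_, ?_⟩
  · refine LipschitzWith.of_dist_le_mul fun x y => ?_
    rw [dist_eq_norm, dist_eq_norm, ← map_sub, NNReal.coe_one, one_mul,
      pi_norm_le_iff_of_nonneg (norm_nonneg _)]
    intro j
    simpa [P] using abs_real_inner_le_norm (b j.succ) (x - y)
  · intro z w h
    have h' := h
    simp only [hΦ] at h'
    exact (MeasurableEquiv.piFinSuccAbove (fun _ => ℝ) 0).symm.injective
      ((WithLp.toLp_injective 2) (b.repr.symm.injective h'))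
  · have := (b.measurePreserving_repr_symm.comp (PiLp.volume_preserving_toLp (Fin (n + 1)))).comp
      ((volume_preserving_piFinSuccAbove (fun _ : Fin (n + 1) => ℝ) 0).symm)
    rw [show (fun z : ℝ × (Fin n → ℝ) => L z.2 + z.1 • d) = _ from funext hΦ]
    exact this

/-- A function growing at least linearly along every line parallel to `d`. -/
def IncreasingAlong {E : Type*} [AddCommGroup E] [Module ℝ E] (c : ℝ) (d : E) (θ : E → ℝ) : Prop :=
  ∀ (y : E) (s : ℝ), 0 ≤ s → θ y + c * s ≤ θ (y + s • d)

theorem IncreasingAlong.exists_root {E : Type*} [NormedAddCommGroup E] [NormedSpace ℝ E]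
    {c : ℝ} (hc : 0 < c) {d : E} {θ : E → ℝ} (hθ : Continuous θ) (h : IncreasingAlong c d θ)
    (y : E) : ∃ t : ℝ, ∀ s : ℝ, (θ (y + s • d) < 0 ↔ s < t) ∧ (0 < θ (y + s • d) ↔ t < s) := by
  have hmono : StrictMono fun s : ℝ => θ (y + s • d) := by
    intro a b hab
    have := h (y + a • d) (b - a) (by linarith)
    rw [add_assoc, ← add_smul, add_sub_cancel] at this
    have : 0 < c * (b - a) := mul_pos hc (by linarith)
    dsimp only
    linarith
  have hcont : Continuous fun s : ℝ => θ (y + s • d) := by fun_prop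
  -- Growth at rate at least `c` forces a sign change within distance `|θ y| / c` of `y`.
  set M := |θ y| / c with hM
  have hMc : c * M = |θ y| := by rw [hM]; field_simp
  have hM0 : 0 ≤ M := by positivity
  have h1 : 0 ≤ θ (y + M • d) := by
    have := h y M hM0
    have := neg_abs_le (θ y)
    linarith
  have h2 : θ (y + (-M) • d) ≤ 0 := by
    have := h (y + (-M) • d) M hM0
    rw [add_assoc, ← add_smul, neg_add_cancel, zero_smul, add_zero] at this
    have := le_abs_self (θ y)
    linarith
  obtain ⟨t, -, ht⟩ := intermediate_value_Icc (show -M ≤ M by linarith) hcont.continuousOn ⟨h2, h1⟩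
  dsimp only at ht
  refine ⟨t, fun s => ⟨?_, ?_⟩⟩
  · simpa only [ht] using hmono.lt_iff_lt (a := s) (b := t)
  · simpa only [ht] using hmono.lt_iff_lt (a := t) (b := s)

/-- Gauss' formula in a direction transversal to a hypersurface, bounded by the values on it. -/
theorem exists_integral_fderiv_le_surface {n : ℕ} {q : ℝ≥0∞} (hq : 1 ≤ q) {c : ℝ} (hc : 0 < c)
    {d : Euc (n + 1)} (hd : ‖d‖ = 1)
    {θ : Euc (n + 1) → ℝ} (hθ : Continuous θ) (hinc : IncreasingAlong c d θ)
    {Ω : Set (Euc (n + 1))} {K : Set (Euc (n + 1))} (hK : IsCompact K)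
    (hB : ∀ y ∈ K, θ y = 0 → y ∈ frontier Ω) :
    ∃ C : ℝ≥0∞, C ≠ ⊤ ∧ ∀ g : Euc (n + 1) → ℝ, ContDiff ℝ 1 g → HasCompactSupport g →
      Function.support g ⊆ K →
      ‖∫ x in {x | θ x < 0}, fderiv ℝ g x d‖ₑ ≤ C * eLpNorm g q (surfaceMeasure Ω) := by
  obtain ⟨L, P, hPlip, hP, hinj, hmp⟩ := exists_orthogonal_coordinates hd
  choose γ hγ using fun y : Fin n → ℝ => hinc.exists_root hc hθ (L y)
  have hγm : Measurable γ := by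
    refine measurable_of_Iio fun a => ?_
    -- The root lies below `a` exactly when `θ` is already positive at height `a`, an open condition
    -- on `y`.
    have : γ ⁻¹' Iio a = (fun y => θ (L y + a • d)) ⁻¹' Ioi 0 := by
      ext y; simpa using ((hγ y a).2).symm
    rw [this]
    exact (isOpen_Ioi.preimage (by fun_prop)).measurableSet
  set T : (Fin n → ℝ) → Euc (n + 1) := fun y => L y + γ y • d with hT
  have hTm : Measurable T := by fun_prop
  have hT0 : ∀ y, θ (T y) = 0 := fun y =>
    le_antisymm (not_lt.1 fun h => lt_irrefl _ ((hγ y (γ y)).2.1 h))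
      (not_lt.1 fun h => lt_irrefl _ ((hγ y (γ y)).1.1 h))
  have hemb : MeasurableEmbedding (fun z : ℝ × (Fin n → ℝ) => L z.2 + z.1 • d) :=
    Continuous.measurableEmbedding (by fun_prop) hinj
  -- the Gauss formula
  have gauss : ∀ g : Euc (n + 1) → ℝ, ContDiff ℝ 1 g → HasCompactSupport g →
      ∫ x in {x | θ x < 0}, fderiv ℝ g x d = ∫ y, g (T y) := by
    intro g hg hgc
    have hmeas : MeasurableSet {x | θ x < 0} := (isOpen_lt hθ continuous_const).measurableSet
    have hint : Integrable (fun x => fderiv ℝ g x d) volume :=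
      ((hg.continuous_fderiv one_ne_zero).clm_apply continuous_const).integrable_of_hasCompactSupport
        (hgc.fderiv_apply ℝ d)
    rw [← integral_indicator hmeas, ← hmp.integral_comp hemb, Measure.volume_eq_prod,
      integral_prod_symm]
    · congr 1
      funext y
      have : ∀ s : ℝ, indicator {x | θ x < 0} (fun x => fderiv ℝ g x d) (L y + s • d) =
          indicator (Iio (γ y)) (deriv fun s : ℝ => g (L y + s • d)) s := by
        intro s
        have hder : HasDerivAt (fun s : ℝ => g (L y + s • d)) (fderiv ℝ g (L y + s • d) d) s := by
          have h1 : HasDerivAt (fun s : ℝ => L y + s • d) d s := by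
            simpa using ((hasDerivAt_id s).smul_const d).const_add (L y)
          exact ((hg.differentiable one_ne_zero _).hasFDerivAt.comp_hasDerivAt s h1)
        simp only [indicator, mem_ofPred_eq, mem_Iio, (hγ y s).1, hder.deriv]
      simp only [this]
      rw [integral_indicator measurableSet_Iio, ← integral_Iic_eq_integral_Iio]
      refine HasCompactSupport.integral_Iic_deriv_eq (f := fun s : ℝ => g (L y + s • d)) (by fun_prop) ?_ _
      refine hgc.comp_isClosedEmbedding ?_
      refine Isometry.isClosedEmbedding (Isometry.of_dist_eq fun a b => ?_)
      rw [dist_add_left, dist_eq_norm, ← sub_smul, norm_smul, hd, mul_one, dist_eq_norm]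
    · have := hmp.integrable_comp_of_integrable (hint.indicator hmeas)
      simpa [Function.comp_def, Measure.volume_eq_prod] using this
  -- comparison of measures
  have hmeasure : ((volume : Measure (Fin n → ℝ)).map T).restrict K ≤ surfaceMeasure Ω := by
    refine Measure.le_iff.2 fun A hA => ?_
    rw [Measure.restrict_apply hA, Measure.map_apply hTm (hA.inter hK.measurableSet),
      surfaceMeasure, Measure.restrict_apply hA]
    -- Lebesgue measure on the parameters is `n`-dimensional Hausdorff measure, and `P` is a
    -- 1-Lipschitz left inverse of the parametrisation `T`. So no area formula is needed: projecting
    -- the graph cannot increase its measure.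
    calc volume (T ⁻¹' (A ∩ K)) = Measure.hausdorffMeasure (n : ℝ) (T ⁻¹' (A ∩ K)) := by
          rw [← hausdorffMeasure_pi_real, Fintype.card_fin]
      _ ≤ Measure.hausdorffMeasure (n : ℝ) (P '' (A ∩ frontier Ω)) := by
          refine measure_mono fun y hy => ⟨T y, ⟨hy.1, hB _ hy.2 (hT0 y)⟩, hP _ _⟩
      _ ≤ _ := by
          have := hPlip.hausdorffMeasure_image_le (d := (n : ℝ)) (by positivity) (A ∩ frontier Ω)
          simpa using this
  have hD : IsCompact (P '' K) := hK.image P.continuous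
  -- This is the Hölder factor between `L¹` and `L^q` on the compact shadow `P '' K`, which contains
  -- the support of `g ∘ T`.
  refine ⟨volume (P '' K) ^ (1 / (1 : ℝ≥0∞).toReal - 1 / q.toReal), ?_, fun g hg hgc hgK => ?_⟩
  · refine ENNReal.rpow_ne_top_of_nonneg ?_ hD.measure_lt_top.ne
    rcases eq_or_ne q ⊤ with rfl | hq'
    · simp
    · have : 1 ≤ q.toReal := by simpa using ENNReal.toReal_mono hq' hq
      simp only [ENNReal.toReal_one, div_one, one_div, sub_nonneg]
      exact inv_le_one_of_one_le₀ this
  · rw [gauss g hg hgc]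
    have hsupp : Function.support (g ∘ T) ⊆ P '' K := fun y hy => ⟨T y, hgK hy, hP _ _⟩
    have hgTm : AEStronglyMeasurable (g ∘ T) volume :=
      (hg.continuous.measurable.comp hTm).aestronglyMeasurable
    calc ‖∫ y, g (T y)‖ₑ ≤ ∫⁻ y, ‖(g ∘ T) y‖ₑ := enorm_integral_le_lintegral_enorm _
      _ = eLpNorm (g ∘ T) 1 (volume.restrict (P '' K)) := by
          rw [eLpNorm_restrict_eq_of_support_subset hsupp, eLpNorm_one_eq_lintegral_enorm]
      _ ≤ eLpNorm (g ∘ T) q (volume.restrict (P '' K)) *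
          (volume.restrict (P '' K)) univ ^ (1 / (1 : ℝ≥0∞).toReal - 1 / q.toReal) :=
          eLpNorm_le_eLpNorm_mul_rpow_measure_univ hq hgTm.restrict
      _ ≤ eLpNorm g q (surfaceMeasure Ω) *
          volume (P '' K) ^ (1 / (1 : ℝ≥0∞).toReal - 1 / q.toReal) := by
          rw [Measure.restrict_apply_univ]
          gcongr
          rw [eLpNorm_restrict_eq_of_support_subset hsupp,
            ← eLpNorm_map_measure hg.continuous.aestronglyMeasurable hTm.aemeasurable,
            ← eLpNorm_restrict_eq_of_support_subset hgK]
          exact eLpNorm_mono_measure _ hmeasure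
      _ = _ := mul_comm _ _

/-! ### Convergence in `L^q`: duality, translations, mollification -/

/-- Hölder's inequality: integration against a function in the dual exponent is continuous. -/
theorem tendsto_integral_smul_of_tendsto_eLpNorm {α V : Type*} [MeasurableSpace α] {μ : Measure α}
    [NormedAddCommGroup V] [NormedSpace ℝ V] {q : ℝ≥0∞} (hq : 1 ≤ q) {m : α → ℝ}
    (hm : MemLp m q.conjExponent μ) {h : α → V} {hk : ℕ → α → V} (hkL : ∀ k, MemLp (hk k) q μ)
    (hL : MemLp h q μ)
    (hlim : Tendsto (fun k => eLpNorm (fun x => hk k x - h x) q μ) atTop (𝓝 0)) :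
    Tendsto (fun k => ∫ x, m x • hk k x ∂μ) atTop (𝓝 (∫ x, m x • h x ∂μ)) := by
  have : ENNReal.HolderConjugate q q.conjExponent := ENNReal.HolderConjugate.conjExponent hq
  have : ENNReal.HolderConjugate q.conjExponent q := ENNReal.HolderConjugate.symm
  refine tendsto_integral_of_L1' _ (hm.1.smul hL.1)
    (Eventually.of_forall fun k => memLp_one_iff_integrable.1 ((hkL k).smul hm)) ?_
  have hbound : ∀ k, eLpNorm ((fun x => m x • hk k x) - fun x => m x • h x) 1 μ ≤
      eLpNorm m q.conjExponent μ * eLpNorm (fun x => hk k x - h x) q μ := by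
    intro k
    have : ((fun x => m x • hk k x) - fun x => m x • h x) = m • fun x => hk k x - h x := by
      funext x; simp [smul_sub]
    rw [this]
    exact eLpNorm_smul_le_mul_eLpNorm ((hkL k).1.sub hL.1) hm.1
  refine tendsto_of_tendsto_of_tendsto_of_le_of_le tendsto_const_nhds ?_
    (fun _ => zero_le) hbound
  simpa using ENNReal.Tendsto.const_mul hlim (Or.inr hm.2.ne)

/-- Translations are continuous in `L^q`. -/
theorem tendsto_eLpNorm_translate_sub {E V : Type*} [NormedAddCommGroup E] [NormedSpace ℝ E] [FiniteDimensional ℝ E]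
    [MeasureSpace E] [BorelSpace E] [(volume : Measure E).IsAddHaarMeasure]
    [NormedAddCommGroup V] 
    {q : ℝ≥0∞} (hq : 1 ≤ q) (hq' : q ≠ ⊤) {g : E → V}
    (hg : MemLp g q volume) :
    Tendsto (fun z => eLpNorm (fun x => g (x - z) - g x) q volume) (𝓝 0) (𝓝 0) := by
  have : Fact (1 ≤ q) := ⟨hq⟩
  let τ : E → C(E, E) := fun z => ⟨fun x => x - z, by fun_prop⟩
  have hτ : Tendsto τ (𝓝 0) (𝓝 (τ 0)) := by
    have : Continuous τ :=
      ContinuousMap.continuous_of_continuous_uncurry _ (by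
        simp only [τ, Function.uncurry_def, ContinuousMap.coe_mk]; fun_prop)
    exact this.tendsto 0
  have hmp : ∀ z, MeasurePreserving (τ z) volume volume := fun z => measurePreserving_sub_right _ z
  have := (tendsto_const_nhds (x := hg.toLp g)).compMeasurePreservingLp hτ hmp (hmp 0) hq'
  rw [Lp.tendsto_Lp_iff_tendsto_eLpNorm'] at this
  refine this.congr fun z => eLpNorm_congr_ae ?_
  have h1 := Lp.coeFn_compMeasurePreserving (hg.toLp g) (hmp z)
  have h2 := Lp.coeFn_compMeasurePreserving (hg.toLp g) (hmp 0)
  have h3 := (hmp z).quasiMeasurePreserving.ae_eq_comp hg.coeFn_toLp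
  have h4 := (hmp 0).quasiMeasurePreserving.ae_eq_comp hg.coeFn_toLp
  filter_upwards [h1, h2, h3, h4] with x h1 h2 h3 h4
  rw [Pi.sub_apply, h1, h2, h3, h4]
  simp [τ]

/-- Mollifications converge in `L^q`. -/
theorem exists_eLpNorm_mollify_sub_le {E V : Type*} [NormedAddCommGroup E] [NormedSpace ℝ E] [FiniteDimensional ℝ E]
    [MeasureSpace E] [BorelSpace E] [(volume : Measure E).IsAddHaarMeasure]
    [NormedAddCommGroup V] [NormedSpace ℝ V] [CompleteSpace V]
    {q : ℝ≥0∞} (hq : 1 ≤ q) (hq' : q ≠ ⊤) {g : E → V}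
    (hgm : StronglyMeasurable g) (hg : MemLp g q volume) {ε : ℝ≥0∞} (hε : ε ≠ 0) :
    ∃ δ > 0, ∀ ρ : E → ℝ, Continuous ρ → HasCompactSupport ρ → (∀ z, 0 ≤ ρ z) → ∫ z, ρ z = 1 →
      (∀ z, ρ z ≠ 0 → ‖z‖ < δ) →
      eLpNorm (fun x => (∫ z, ρ z • g (x - z)) - g x) q volume ≤ ε := by
  obtain ⟨δ, hδ, hδε⟩ := Metric.eventually_nhds_iff.1
    ((tendsto_eLpNorm_translate_sub hq hq' hg).eventually (Iic_mem_nhds (pos_iff_ne_zero.2 hε)))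
  refine ⟨δ, hδ, fun ρ hρ hρc hρ0 hρ1 hρδ => ?_⟩
  have hq0 : q ≠ 0 := (zero_lt_one.trans_le hq).ne'
  have hqr : 0 < q.toReal := ENNReal.toReal_pos hq0 hq'
  -- As `ν` is a probability measure, the `q`-th power of the averaged error is at most the average
  -- of the `q`-th powers; Tonelli then bounds the mollification error by the translation errors for
  -- `z` in the support of `ρ`.
  set ν : Measure E := volume.withDensity fun z => ENNReal.ofReal (ρ z) with hν
  have hρi : Integrable ρ volume := hρ.integrable_of_hasCompactSupport hρc
  have hρm : Measurable fun z => ENNReal.ofReal (ρ z) := hρ.measurable.ennreal_ofReal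
  have : IsProbabilityMeasure ν := ⟨by
    rw [hν, withDensity_apply _ MeasurableSet.univ, Measure.restrict_univ,
      ← ofReal_integral_eq_lintegral_ofReal hρi (ae_of_all _ hρ0), hρ1, ENNReal.ofReal_one]⟩
  have hint : ∀ f : E → V, ∫ z, f z ∂ν = ∫ z, ρ z • f z := fun f => by
    rw [hν, integral_withDensity_eq_integral_toReal_smul hρm (ae_of_all _ fun _ => ENNReal.ofReal_lt_top)]
    simp only [ENNReal.toReal_ofReal (hρ0 _)]
  have hgl : LocallyIntegrable g volume := hg.locallyIntegrable hq
  have hconv : ∀ x, Integrable (fun z => g (x - z)) ν := fun x => by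
    rw [hν, integrable_withDensity_iff_integrable_smul' hρm (ae_of_all _ fun _ => ENNReal.ofReal_lt_top)]
    simp only [ENNReal.toReal_ofReal (hρ0 _)]
    exact hρc.convolutionExists_left (ContinuousLinearMap.lsmul ℝ ℝ) hρ hgl x
  have hbound : ∀ x, ‖(∫ z, ρ z • g (x - z)) - g x‖ₑ ^ q.toReal ≤
      ∫⁻ z, ‖g (x - z) - g x‖ₑ ^ q.toReal ∂ν := by
    intro x
    have hm : AEStronglyMeasurable (fun z => g (x - z) - g x) ν :=
      ((hgm.comp_measurable (by fun_prop)).sub stronglyMeasurable_const).aestronglyMeasurable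
    have h1 : (∫ z, ρ z • g (x - z)) - g x = ∫ z, (g (x - z) - g x) ∂ν := by
      rw [integral_sub (hconv x) (integrable_const _), hint, integral_const]
      simp
    have h2 : ‖∫ z, (g (x - z) - g x) ∂ν‖ₑ ≤ eLpNorm (fun z => g (x - z) - g x) q ν := by
      refine le_trans (enorm_integral_le_lintegral_enorm _) ?_
      rw [← eLpNorm_one_eq_lintegral_enorm]
      exact eLpNorm_le_eLpNorm_of_exponent_le hq hm
    rw [h1]
    refine (ENNReal.rpow_le_rpow h2 hqr.le).trans_eq ?_
    rw [eLpNorm_eq_lintegral_rpow_enorm_toReal hq0 hq', ← ENNReal.rpow_mul,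
      one_div_mul_cancel hqr.ne', ENNReal.rpow_one]
  rw [eLpNorm_eq_lintegral_rpow_enorm_toReal hq0 hq', one_div, ENNReal.rpow_inv_le_iff hqr]
  calc ∫⁻ x, ‖(∫ z, ρ z • g (x - z)) - g x‖ₑ ^ q.toReal
      ≤ ∫⁻ x, ∫⁻ z, ‖g (x - z) - g x‖ₑ ^ q.toReal ∂ν := lintegral_mono hbound
    _ = ∫⁻ z, ∫⁻ x, ‖g (x - z) - g x‖ₑ ^ q.toReal ∂volume ∂ν := by
        refine lintegral_lintegral_swap (Measurable.aemeasurable ?_)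
        refine Measurable.pow_const (StronglyMeasurable.enorm ?_) _
        exact (hgm.comp_measurable (by fun_prop)).sub (hgm.comp_measurable (by fun_prop))
    _ ≤ ∫⁻ z, ε ^ q.toReal ∂ν := by
        refine lintegral_mono_ae ?_
        have : ∀ᵐ z ∂ν, ρ z ≠ 0 := by
          rw [hν, ae_withDensity_iff hρm]
          exact ae_of_all _ fun z hz h => hz (by simp [h])
        filter_upwards [this] with z hz
        have h := hδε (y := z) (by simpa using hρδ z hz)
        rw [eLpNorm_eq_lintegral_rpow_enorm_toReal hq0 hq',
          one_div, ENNReal.rpow_inv_le_iff hqr] at h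
        exact h
    _ = ε ^ q.toReal := by simp

/-! ### Gradient calculus and weak gradients of mollifications -/

section Gradient

variable {E : Type*} [NormedAddCommGroup E] [InnerProductSpace ℝ E] [CompleteSpace E]

theorem gradient_eq_of_fderiv_eq {f : E → ℝ} {x v : E} (h : ∀ d, fderiv ℝ f x d = ⟪v, d⟫) :
    gradient f x = v :=
  ext_inner_right ℝ fun d => by rw [inner_gradient_left, h]

theorem gradient_mul {f g : E → ℝ} {x : E} (hf : DifferentiableAt ℝ f x)
    (hg : DifferentiableAt ℝ g x) :
    gradient (fun y => f y * g y) x = f x • gradient g x + g x • gradient f x := by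
  refine gradient_eq_of_fderiv_eq fun d => ?_
  rw [fderiv_fun_mul hf hg]
  simp [inner_add_left, inner_smul_left, inner_gradient_left]

theorem gradient_sub {f g : E → ℝ} {x : E} (hf : DifferentiableAt ℝ f x)
    (hg : DifferentiableAt ℝ g x) :
    gradient (fun y => f y - g y) x = gradient f x - gradient g x := by
  refine gradient_eq_of_fderiv_eq fun d => ?_
  rw [fderiv_fun_sub hf hg]
  simp [inner_sub_left, inner_gradient_left]

theorem gradient_add {f g : E → ℝ} {x : E} (hf : DifferentiableAt ℝ f x)
    (hg : DifferentiableAt ℝ g x) :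
    gradient (fun y => f y + g y) x = gradient f x + gradient g x := by
  refine gradient_eq_of_fderiv_eq fun d => ?_
  rw [fderiv_fun_add hf hg]
  simp [inner_add_left, inner_gradient_left]

theorem gradient_comp_real {β : ℝ → ℝ} {f : E → ℝ} {x : E} (hβ : DifferentiableAt ℝ β (f x))
    (hf : DifferentiableAt ℝ f x) :
    gradient (fun y => β (f y)) x = deriv β (f x) • gradient f x := by
  refine gradient_eq_of_fderiv_eq fun d => ?_
  have := (hβ.hasDerivAt.comp_hasFDerivAt x hf.hasFDerivAt).fderiv
  rw [show (fun y => β (f y)) = β ∘ f from rfl, this]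
  simp [inner_smul_left, inner_gradient_left]

theorem continuous_gradient {f : E → ℝ} (hf : ContDiff ℝ 1 f) : Continuous (gradient f) :=
  (InnerProductSpace.toDual ℝ E).symm.continuous.comp (hf.continuous_fderiv one_ne_zero)

theorem support_gradient_subset_tsupport (f : E → ℝ) :
    Function.support (gradient f) ⊆ tsupport f := fun x hx =>
  support_fderiv_subset ℝ fun h => hx (by simp [gradient, h])

theorem HasCompactSupport.gradient {f : E → ℝ} (hf : HasCompactSupport f) :
    HasCompactSupport (gradient f) :=
  hf.mono' (support_gradient_subset_tsupport f)

end Gradient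

/-- Mollification commutes with the weak gradient on the whole space. -/
theorem contDiff_mollify_and_gradient {N : ℕ} {f : Euc N → ℝ} {H : Euc N → Euc N}
    (hf : LocallyIntegrable f volume) (hH : LocallyIntegrable H volume)
    (hweak : ∀ ψ : Euc N → ℝ, ContDiff ℝ ∞ ψ → HasCompactSupport ψ →
      ∫ x, f x • gradient ψ x = - ∫ x, ψ x • H x)
    {ρ : Euc N → ℝ} (hρ : ContDiff ℝ ∞ ρ) (hρc : HasCompactSupport ρ) :
    ContDiff ℝ ∞ (fun x => ∫ z, ρ z • f (x - z)) ∧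
      ∀ x, gradient (fun x => ∫ z, ρ z • f (x - z)) x = ∫ z, ρ z • H (x - z) := by
  refine ⟨hρc.contDiff_convolution_left (ContinuousLinearMap.lsmul ℝ ℝ) hρ hf, fun x => ?_⟩
  have hρ1 : ContDiff ℝ 1 ρ := hρ.of_le (by exact_mod_cast le_top)
  refine gradient_eq_of_fderiv_eq fun d => ?_
  have h1 := (hρc.hasFDerivAt_convolution_left (ContinuousLinearMap.lsmul ℝ ℝ) hρ1 hf x).fderiv
  have hint := (hρc.fderiv ℝ).convolutionExists_left
    (ContinuousLinearMap.precompL (Euc N) (ContinuousLinearMap.lsmul ℝ ℝ))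
    (hρ1.continuous_fderiv one_ne_zero) hf x
  have h2 : fderiv ℝ (fun x => ∫ z, ρ z • f (x - z)) x d =
      ∫ z, fderiv ℝ ρ z d • f (x - z) := by
    refine (congrArg (fun A : Euc N →L[ℝ] ℝ => A d) h1).trans ?_
    exact ContinuousLinearMap.integral_apply hint d
  -- The weak gradient is tested with the reflected kernel; the sign from differentiating `x - y`
  -- cancels the one from integration by parts.
  have hψ : ContDiff ℝ ∞ fun y => ρ (x - y) := hρ.comp (contDiff_const.sub contDiff_id)
  have hψc : HasCompactSupport fun y => ρ (x - y) :=
    hρc.comp_homeomorph (Homeomorph.subLeft x)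
  have hder : ∀ y, ⟪gradient (fun y => ρ (x - y)) y, d⟫ = - fderiv ℝ ρ (x - y) d := by
    intro y
    rw [inner_gradient_left]
    have : HasFDerivAt (fun y => ρ (x - y)) ((fderiv ℝ ρ (x - y)).comp (-ContinuousLinearMap.id ℝ (Euc N))) y :=
      (hρ1.differentiable one_ne_zero _).hasFDerivAt.comp y ((hasFDerivAt_id y).const_sub x)
    rw [this.fderiv]
    simp
  have hi1 : Integrable fun y => f y • gradient (fun y => ρ (x - y)) y :=
    hf.integrable_smul_right_of_hasCompactSupport
      (continuous_gradient (hψ.of_le (by exact_mod_cast le_top))) hψc.gradient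
  have hi2 : Integrable fun y => ρ (x - y) • H y :=
    hH.integrable_smul_left_of_hasCompactSupport hψ.continuous hψc
  have hw := congrArg (fun v => ⟪d, v⟫) (hweak _ hψ hψc)
  rw [inner_neg_right, ← integral_inner hi1, ← integral_inner hi2] at hw
  rw [h2, ← integral_sub_left_eq_self _ volume x, ← integral_sub_left_eq_self (fun z => ρ z • H (x - z)) volume x,
    real_inner_comm, ← integral_inner (by simpa using hi2)]
  simp only [sub_sub_cancel]
  rw [← neg_eq_iff_eq_neg.2 hw, ← integral_neg]
  congr 1
  funext y
  rw [inner_smul_right, real_inner_comm, hder]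
  simp [mul_comm]

/-- `w`, with gradient `H`, is a limit in `W^{1,q}(U)` of smooth functions compactly supported
in `U`. -/
def SmoothCompactApprox {N : ℕ} (q : ℝ≥0∞) (U : Set (Euc N)) (w : Euc N → ℝ)
    (H : Euc N → Euc N) : Prop :=
  ∀ ε : ℝ≥0∞, ε ≠ 0 → ∃ ψ : Euc N → ℝ, ContDiff ℝ ∞ ψ ∧ HasCompactSupport ψ ∧ tsupport ψ ⊆ U ∧
    eLpNorm (fun x => ψ x - w x) q (volume.restrict U) ≤ ε ∧
    eLpNorm (fun x => gradient ψ x - H x) q (volume.restrict U) ≤ ε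

/-! ### Lipschitz charts of the boundary -/

section Chart

variable {N : ℕ}

/-- The height above the graph of `γ` in the direction `e`. -/
def graphHeight (e : Euc N) (γ : Euc N → ℝ) (y : Euc N) : ℝ := ⟪e, y⟫ - γ (y - ⟪e, y⟫ • e)

theorem norm_sub_inner_smul_le {e : Euc N} (he : ‖e‖ = 1) (v : Euc N) :
    ‖v - ⟪e, v⟫ • e‖ ≤ ‖v‖ := by
  have h : ‖v - ⟪e, v⟫ • e‖ ^ 2 = ‖v‖ ^ 2 - ⟪e, v⟫ ^ 2 := by
    rw [norm_sub_sq_real, inner_smul_right, norm_smul, he, real_inner_comm e v]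
    simp only [mul_one, Real.norm_eq_abs, sq_abs]
    ring
  exact (pow_le_pow_iff_left₀ (norm_nonneg _) (norm_nonneg _) two_ne_zero).1
    (by rw [h]; linarith [sq_nonneg ⟪e, v⟫])

/-- A displacement changes the vertical coordinate by exactly `⟪e, v⟫`, and changes `γ` by at most
`K` times its horizontal length. The lower bound gives monotonicity along transversal directions;
the upper bound controls where a shifted mollifier carries the support. -/
theorem graphHeight_add_le (e : Euc N) {γ : Euc N → ℝ} {K : NNReal}
    (hγ : LipschitzWith K γ) (y v : Euc N) :
    graphHeight e γ y + (⟪e, v⟫ - K * ‖v - ⟪e, v⟫ • e‖) ≤ graphHeight e γ (y + v) ∧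
    graphHeight e γ (y + v) ≤ graphHeight e γ y + (⟪e, v⟫ + K * ‖v - ⟪e, v⟫ • e‖) := by
  have h := hγ.dist_le_mul (y + v - ⟪e, y + v⟫ • e) (y - ⟪e, y⟫ • e)
  have h' : (y + v - ⟪e, y + v⟫ • e) - (y - ⟪e, y⟫ • e) = v - ⟪e, v⟫ • e := by
    rw [inner_add_right, add_smul]; abel
  rw [dist_eq_norm, dist_eq_norm, h', Real.norm_eq_abs, abs_le] at h
  unfold graphHeight
  rw [inner_add_right] at h ⊢
  constructor <;> linarith [h.1, h.2]

theorem continuous_graphHeight (e : Euc N) {γ : Euc N → ℝ} {K : NNReal}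
    (hγ : LipschitzWith K γ) : Continuous (graphHeight e γ) := by
  have := hγ.continuous
  unfold graphHeight
  fun_prop

/-- The graph height increases along `d` if `d` is transversal to the graph. -/
theorem increasingAlong_graphHeight (e : Euc N) {γ : Euc N → ℝ} {K : NNReal}
    (hγ : LipschitzWith K γ) (d : Euc N) :
    IncreasingAlong (⟪e, d⟫ - K * ‖d - ⟪e, d⟫ • e‖) d (graphHeight e γ) := by
  intro y s hs
  have h := (graphHeight_add_le e hγ y (s • d)).1
  rw [inner_smul_right, mul_smul, ← smul_sub, norm_smul, Real.norm_of_nonneg hs] at h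
  linarith

/-- Near a boundary point, `∂Ω` and `Ωᵉ` are given by the sign of the graph height. -/
theorem chart_frontier_and_extDomain {Ω : Set (Euc N)} (hΩ : IsOpen Ω) {e : Euc N} (he : ‖e‖ = 1)
    {γ : Euc N → ℝ} {K : NNReal} (hγ : LipschitzWith K γ) {B : Set (Euc N)} (hB : IsOpen B)
    (hchart : ∀ y ∈ B, (y ∈ Ω ↔ 0 < graphHeight e γ y)) {y : Euc N} (hy : y ∈ B) :
    (graphHeight e γ y = 0 → y ∈ frontier Ω) ∧ (y ∈ extDomain Ω ↔ graphHeight e γ y < 0) := by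
  have h0 : graphHeight e γ y = 0 → y ∈ frontier Ω := by
    intro h
    rw [hΩ.frontier_eq]
    refine ⟨?_, fun hyΩ => ((hchart y hy).1 hyΩ).ne' h⟩
    -- Moving up along `e` makes the height positive, so `y` is a limit of points of `Ω`.
    have hlim : Tendsto (fun s : ℝ => y + s • e) (𝓝[>] 0) (𝓝 y) := by
      have : Continuous fun s : ℝ => y + s • e := by fun_prop
      simpa using (this.tendsto 0).mono_left nhdsWithin_le_nhds
    refine mem_closure_of_tendsto hlim ?_
    filter_upwards [hlim.eventually (hB.mem_nhds hy), self_mem_nhdsWithin] with s hs hs0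
    rw [hchart _ hs]
    have := increasingAlong_graphHeight e hγ e y s (le_of_lt hs0)
    have hs0 : 0 < s := hs0
    simp only [real_inner_self_eq_norm_sq, he, h] at this
    simp at this
    linarith
  refine ⟨h0, ?_, ?_⟩
  · intro hyU
    have h1 : ¬ 0 < graphHeight e γ y := fun h => hyU (subset_closure ((hchart y hy).2 h))
    refine lt_of_le_of_ne (not_lt.1 h1) fun h => hyU (frontier_subset_closure (h0 h))
  · intro h hyc
    have hopen : IsOpen (B ∩ {y | graphHeight e γ y < 0}) :=
      hB.inter (isOpen_lt (continuous_graphHeight e hγ) continuous_const)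
    obtain ⟨z, ⟨hzB, hz⟩, hzΩ⟩ := mem_closure_iff.1 hyc _ hopen ⟨hy, h⟩
    exact lt_asymm hz ((hchart z hzB).1 hzΩ)

end Chart

/-! ### Zero boundary values near a single boundary point -/

theorem contDiff_one_of_infty {E : Type*} [NormedAddCommGroup E] [NormedSpace ℝ E] {f : E → ℝ}
    (hf : ContDiff ℝ ∞ f) : ContDiff ℝ 1 f := hf.of_le (by exact_mod_cast le_top)

theorem HasCompactSupport.exists_norm_le {X V : Type*} [TopologicalSpace X]
    [SeminormedAddCommGroup V] {f : X → V} (hf : HasCompactSupport f) (hc : Continuous f) :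
    ∃ C : ℝ, 0 ≤ C ∧ ∀ x, ‖f x‖ ≤ C := by
  obtain ⟨C, hC⟩ := hf.exists_bound_of_continuous hc
  exact ⟨max C 0, le_max_right _ _, fun x => (hC x).trans (le_max_left _ _)⟩

/-- A vector orthogonal to all directions near a given non-zero direction vanishes. -/
theorem eq_zero_of_inner_eq_zero_near {E : Type*} [NormedAddCommGroup E] [InnerProductSpace ℝ E]
    {e v : E} (h : ∀ᶠ d in 𝓝 e, ⟪v, d⟫ = 0) : v = 0 := by
  have h0 : ⟪v, e⟫ = 0 := h.self_of_nhds
  -- The direction `e` is perturbed by `v` itself: since `⟪v, e⟫ = 0`, pairing `v` with `e + t • v`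
  -- leaves `t ‖v‖²`.
  have hlim : Tendsto (fun t : ℝ => e + t • v) (𝓝[>] 0) (𝓝 e) := by
    have : Continuous fun t : ℝ => e + t • v := by fun_prop
    simpa using (this.tendsto 0).mono_left nhdsWithin_le_nhds
  obtain ⟨t, ht, ht0⟩ := ((hlim.eventually h).and self_mem_nhdsWithin).exists
  rw [inner_add_right, h0, inner_smul_right, zero_add] at ht
  exact inner_self_eq_zero.1 ((mul_eq_zero.1 ht).resolve_left (ne_of_gt ht0))

/-- If the boundary values of `f k` tend to zero, the limit of the `f k`, extended by zero across
the boundary, is weakly differentiable near a boundary point. -/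
theorem integral_smul_gradient_extDomain_of_chart {n : ℕ} {q : ℝ≥0∞} (hq : 1 ≤ q)
    {Ω : Set (Euc (n + 1))} (hΩ : IsOpen Ω) {e : Euc (n + 1)} (he : ‖e‖ = 1)
    {γ : Euc (n + 1) → ℝ} {L : NNReal} (hγ : LipschitzWith L γ) {B : Set (Euc (n + 1))}
    (hB : IsOpen B) (hchart : ∀ y ∈ B, (y ∈ Ω ↔ 0 < graphHeight e γ y))
    {K : Set (Euc (n + 1))} (hK : IsCompact K) (hKB : K ⊆ B)
    {f : ℕ → Euc (n + 1) → ℝ} (hf : ∀ k, ContDiff ℝ ∞ (f k)) (hfK : ∀ k, tsupport (f k) ⊆ K)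
    {w : Euc (n + 1) → ℝ} {H : Euc (n + 1) → Euc (n + 1)}
    (hw : MemLp w q (volume.restrict (extDomain Ω)))
    (hH : MemLp H q (volume.restrict (extDomain Ω)))
    (hlim : Tendsto (fun k => eLpNorm (fun x => f k x - w x) q (volume.restrict (extDomain Ω)))
      atTop (𝓝 0))
    (hlim' : Tendsto (fun k => eLpNorm (fun x => gradient (f k) x - H x) q
      (volume.restrict (extDomain Ω))) atTop (𝓝 0))
    (htrace : Tendsto (fun k => eLpNorm (f k) q (surfaceMeasure Ω)) atTop (𝓝 0))
    {ψ : Euc (n + 1) → ℝ} (hψ : ContDiff ℝ ∞ ψ) (hψc : HasCompactSupport ψ) :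
    ∫ x in extDomain Ω, w x • gradient ψ x = - ∫ x in extDomain Ω, ψ x • H x := by
  have hfc : ∀ k, HasCompactSupport (f k) := fun k =>
    hK.of_isClosed_subset (isClosed_tsupport _) (hfK k)
  have hψ1 := contDiff_one_of_infty hψ
  have hf1 := fun k => contDiff_one_of_infty (hf k)
  have hUo : IsOpen (extDomain Ω) := isClosed_closure.isOpen_compl
  have hfLp : ∀ k, MemLp (f k) q (volume.restrict (extDomain Ω)) := fun k =>
    ((hf k).continuous.memLp_of_hasCompactSupport (hfc k)).restrict _
  have hgLp : ∀ k, MemLp (gradient (f k)) q (volume.restrict (extDomain Ω)) := fun k =>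
    ((continuous_gradient (hf1 k)).memLp_of_hasCompactSupport (hfc k).gradient).restrict _
  have hψLp : MemLp ψ q.conjExponent (volume.restrict (extDomain Ω)) :=
    (hψ.continuous.memLp_of_hasCompactSupport hψc).restrict _
  have : ENNReal.HolderConjugate q q.conjExponent := ENNReal.HolderConjugate.conjExponent hq
  have : ENNReal.HolderConjugate q.conjExponent q := ENNReal.HolderConjugate.symm
  have hi1 : ∀ {g : Euc (n + 1) → ℝ}, MemLp g q (volume.restrict (extDomain Ω)) →
      Integrable (fun x => g x • gradient ψ x) (volume.restrict (extDomain Ω)) := fun {g} hg =>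
    memLp_one_iff_integrable.1 (MemLp.smul (p := q) (q := q.conjExponent)
      (((continuous_gradient hψ1).memLp_of_hasCompactSupport hψc.gradient).restrict _) hg)
  have hi2 : ∀ {G : Euc (n + 1) → Euc (n + 1)}, MemLp G q (volume.restrict (extDomain Ω)) →
      Integrable (fun x => ψ x • G x) (volume.restrict (extDomain Ω)) := fun {g} hg =>
    memLp_one_iff_integrable.1 (hg.smul hψLp)
  obtain ⟨Cψ, hCψ0, hCψ⟩ := hψc.exists_norm_le hψ.continuous
  -- the defect in the integration by parts
  set s : Euc (n + 1) := (∫ x in extDomain Ω, w x • gradient ψ x) + ∫ x in extDomain Ω, ψ x • H x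
    with hs
  set sk : ℕ → Euc (n + 1) := fun k => (∫ x in extDomain Ω, f k x • gradient ψ x) +
    ∫ x in extDomain Ω, ψ x • gradient (f k) x with hsk
  suffices h : s = 0 from eq_neg_of_add_eq_zero_left h
  have hinner : ∀ {g : Euc (n + 1) → ℝ} {G : Euc (n + 1) → Euc (n + 1)},
      MemLp g q (volume.restrict (extDomain Ω)) → MemLp G q (volume.restrict (extDomain Ω)) →
      ∀ d, ⟪d, (∫ x in extDomain Ω, g x • gradient ψ x) + ∫ x in extDomain Ω, ψ x • G x⟫ =
        (∫ x in extDomain Ω, fderiv ℝ ψ x d • g x) + ∫ x in extDomain Ω, ψ x • ⟪d, G x⟫ := by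
    intro g G hg hG d
    rw [inner_add_right, ← integral_inner (hi1 hg), ← integral_inner (hi2 hG)]
    simp only [inner_smul_right, inner_gradient_right, smul_eq_mul, mul_comm, conj_trivial]
  have hsklim : ∀ d, Tendsto (fun k => ⟪d, sk k⟫) atTop (𝓝 ⟪d, s⟫) := by
    intro d
    simp only [hs, hsk, hinner (hfLp _) (hgLp _), hinner hw hH]
    refine Tendsto.add ?_ ?_
    · refine tendsto_integral_smul_of_tendsto_eLpNorm hq ?_ hfLp hw hlim
      exact (((hψ1.continuous_fderiv one_ne_zero).clm_apply continuous_const).memLp_of_hasCompactSupport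
        (hψc.fderiv_apply ℝ d)).restrict _
    · refine tendsto_integral_smul_of_tendsto_eLpNorm hq hψLp
        (fun k => (hgLp k).const_inner d) (hH.const_inner d) ?_
      refine tendsto_of_tendsto_of_tendsto_of_le_of_le tendsto_const_nhds
        (g := fun _ => 0) (h := fun k => ENNReal.ofReal ‖d‖ * eLpNorm (fun x => gradient (f k) x - H x) q
        (volume.restrict (extDomain Ω))) ?_ (fun _ => zero_le) fun k => ?_
      · simpa using ENNReal.Tendsto.const_mul (a := ENNReal.ofReal ‖d‖) hlim'
          (Or.inr ENNReal.ofReal_ne_top)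
      · refine eLpNorm_le_mul_eLpNorm_of_ae_le_mul (ae_of_all _ fun x => ?_) _
        rw [← inner_sub_right]
        exact norm_inner_le_norm _ _
  -- The Gauss formula is available only in directions transversal to the graph. These form a
  -- neighbourhood of `e`, which is enough to annihilate the vector `s`.
  refine eq_zero_of_inner_eq_zero_near (e := e) ?_
  have htrans : ∀ᶠ d in 𝓝 e, 0 < ⟪e, d⟫ - L * ‖d - ⟪e, d⟫ • e‖ := by
    have hcont : Continuous fun d : Euc (n + 1) => ⟪e, d⟫ - L * ‖d - ⟪e, d⟫ • e‖ := by fun_prop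
    refine hcont.continuousAt.eventually (lt_mem_nhds ?_)
    simp [he]
  have hne : ∀ᶠ d in 𝓝 e, d ≠ 0 := isOpen_ne.mem_nhds (by rintro rfl; simp at he)
  filter_upwards [htrans, hne] with d hd hd0
  have hdpos : 0 < ‖d‖ := norm_pos_iff.2 hd0
  -- rescale to a unit vector
  set d' : Euc (n + 1) := ‖d‖⁻¹ • d with hd'
  have hd'1 : ‖d'‖ = 1 := by rw [hd', norm_smul, norm_inv, norm_norm, inv_mul_cancel₀ hdpos.ne']
  have hd'c : 0 < ⟪e, d'⟫ - L * ‖d' - ⟪e, d'⟫ • e‖ := by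
    have : ⟪e, d'⟫ - L * ‖d' - ⟪e, d'⟫ • e‖ = ‖d‖⁻¹ * (⟪e, d⟫ - L * ‖d - ⟪e, d⟫ • e‖) := by
      rw [hd', inner_smul_right, mul_smul, ← smul_sub, norm_smul, norm_inv, norm_norm]; ring
    rw [this]; positivity
  suffices h : ⟪d', s⟫ = 0 by
    rw [hd', inner_smul_left] at h
    rw [real_inner_comm]
    simpa [hdpos.ne'] using h
  obtain ⟨C, hC, hCg⟩ := exists_integral_fderiv_le_surface hq hd'c hd'1
    (continuous_graphHeight e hγ) (increasingAlong_graphHeight e hγ d') hK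
    (fun y hy => (chart_frontier_and_extDomain hΩ he hγ hB hchart (hKB hy)).1)
  have hbound : ∀ k, ‖⟪d', sk k⟫‖ₑ ≤
      C * ENNReal.ofReal Cψ * eLpNorm (f k) q (surfaceMeasure Ω) := by
    intro k
    -- For smooth `f k` the defect in direction `d'` is the integral of the derivative of `f k * ψ`
    -- over the exterior domain, which the Gauss formula bounds by the boundary values of `f k`.
    set g : Euc (n + 1) → ℝ := fun x => f k x * ψ x with hg
    have hg1 : ContDiff ℝ 1 g := (hf1 k).mul hψ1
    have hgK : tsupport g ⊆ K := (tsupport_mul_subset_left).trans (hfK k)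
    have hgc : HasCompactSupport g := (hfc k).mul_right
    have heq : ⟪d', sk k⟫ = ∫ x in {x | graphHeight e γ x < 0}, fderiv ℝ g x d' := by
      have hm : MeasurableSet {x | graphHeight e γ x < 0} :=
        (isOpen_lt (continuous_graphHeight e hγ) continuous_const).measurableSet
      -- On `K` the exterior domain is the set of negative height; off `K` the derivative of `g`
      -- vanishes.
      have hind : indicator {x | graphHeight e γ x < 0} (fun x => fderiv ℝ g x d') =
          indicator (extDomain Ω) (fun x => fderiv ℝ g x d') := by
        funext x
        by_cases hx : x ∈ K
        · simp only [indicator, mem_ofPred_eq,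
            (chart_frontier_and_extDomain hΩ he hγ hB hchart (hKB hx)).2]
        · have : fderiv ℝ g x = 0 := by
            by_contra h
            exact hx (hgK (support_fderiv_subset ℝ h))
          simp [indicator, this]
      rw [← integral_indicator hm, hind, integral_indicator hUo.measurableSet, hsk,
        hinner (hfLp k) (hgLp k), ← integral_add]
      · refine integral_congr_ae (ae_of_all _ fun x => ?_)
        simp only [hg]
        rw [fderiv_fun_mul ((hf1 k).differentiable one_ne_zero x) (hψ1.differentiable one_ne_zero x),
          inner_gradient_right]
        simp [mul_comm]
      · have := (hi1 (hfLp k)).const_inner (𝕜 := ℝ) d'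
        simpa [inner_smul_right, inner_gradient_right, mul_comm] using this
      · have := (hi2 (hgLp k)).const_inner (𝕜 := ℝ) d'
        simpa [inner_smul_right] using this
    rw [heq]
    refine (hCg g hg1 hgc ((subset_tsupport g).trans hgK)).trans ?_
    rw [mul_assoc]
    gcongr
    refine eLpNorm_le_mul_eLpNorm_of_ae_le_mul (ae_of_all _ fun x => ?_) _
    rw [hg, norm_mul, mul_comm]
    gcongr
    exact hCψ x
  have hzero : Tendsto (fun k => ⟪d', sk k⟫) atTop (𝓝 0) := by
    rw [tendsto_iff_edist_tendsto_0]
    simp only [edist_zero_right]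
    refine tendsto_of_tendsto_of_tendsto_of_le_of_le tendsto_const_nhds
      ?_ (fun _ => zero_le) hbound
    simpa using ENNReal.Tendsto.const_mul htrace
      (Or.inr (ENNReal.mul_ne_top hC ENNReal.ofReal_ne_top))
  exact tendsto_nhds_unique (hsklim d') hzero
/-- Near a boundary point, a `W^{1,q}` limit of smooth functions whose boundary values tend to zero
is a limit of smooth functions compactly supported in the exterior domain. -/
theorem smoothCompactApprox_of_chart {n : ℕ} {q : ℝ≥0∞} (hq : 1 ≤ q) (hq' : q ≠ ⊤)
    {Ω : Set (Euc (n + 1))} (hΩ : IsOpen Ω) {e : Euc (n + 1)} (he : ‖e‖ = 1)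
    {γ : Euc (n + 1) → ℝ} {L : NNReal} (hγ : LipschitzWith L γ) {B : Set (Euc (n + 1))}
    (hB : IsOpen B) (hchart : ∀ y ∈ B, (y ∈ Ω ↔ 0 < graphHeight e γ y))
    {K : Set (Euc (n + 1))} (hK : IsCompact K) (hKB : K ⊆ B)
    {f : ℕ → Euc (n + 1) → ℝ} (hf : ∀ k, ContDiff ℝ ∞ (f k)) (hfK : ∀ k, tsupport (f k) ⊆ K)
    {w : Euc (n + 1) → ℝ} {H : Euc (n + 1) → Euc (n + 1)}
    (hw : MemLp w q (volume.restrict (extDomain Ω)))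
    (hH : MemLp H q (volume.restrict (extDomain Ω)))
    (hwK : ∀ x ∉ K, w x = 0) (hHK : ∀ x ∉ K, H x = 0)
    (hlim : Tendsto (fun k => eLpNorm (fun x => f k x - w x) q (volume.restrict (extDomain Ω)))
      atTop (𝓝 0))
    (hlim' : Tendsto (fun k => eLpNorm (fun x => gradient (f k) x - H x) q
      (volume.restrict (extDomain Ω))) atTop (𝓝 0))
    (htrace : Tendsto (fun k => eLpNorm (f k) q (surfaceMeasure Ω)) atTop (𝓝 0)) :
    SmoothCompactApprox q (extDomain Ω) w H := by
  intro ε hε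
  have hUo : IsOpen (extDomain Ω) := isClosed_closure.isOpen_compl
  have hUm := hUo.measurableSet
  have hKm := hK.measurableSet
  -- measurable representatives of the extensions by zero
  set w' : Euc (n + 1) → ℝ := indicator (extDomain Ω ∩ K) (hw.1.mk w) with hw'
  set H' : Euc (n + 1) → Euc (n + 1) := indicator (extDomain Ω ∩ K) (hH.1.mk H) with hH'
  have hw'm : StronglyMeasurable w' := hw.1.stronglyMeasurable_mk.indicator (hUm.inter hKm)
  have hH'm : StronglyMeasurable H' := hH.1.stronglyMeasurable_mk.indicator (hUm.inter hKm)
  have hww' : w =ᵐ[volume.restrict (extDomain Ω)] w' := by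
    filter_upwards [hw.1.ae_eq_mk, ae_restrict_mem hUm] with x hx hxU
    by_cases hxK : x ∈ K
    · rw [hw', indicator_of_mem (show x ∈ extDomain Ω ∩ K from ⟨hxU, hxK⟩), hx]
    · rw [hw', indicator_of_notMem (fun h => hxK h.2), hwK x hxK]
  have hHH' : H =ᵐ[volume.restrict (extDomain Ω)] H' := by
    filter_upwards [hH.1.ae_eq_mk, ae_restrict_mem hUm] with x hx hxU
    by_cases hxK : x ∈ K
    · rw [hH', indicator_of_mem (show x ∈ extDomain Ω ∩ K from ⟨hxU, hxK⟩), hx]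
    · rw [hH', indicator_of_notMem (fun h => hxK h.2), hHK x hxK]
  have hw'U : indicator (extDomain Ω) w' = w' := by
    rw [hw', indicator_indicator, ← inter_assoc, inter_self]
  have hH'U : indicator (extDomain Ω) H' = H' := by
    rw [hH', indicator_indicator, ← inter_assoc, inter_self]
  have hw'L : MemLp w' q volume := by
    rw [← hw'U, memLp_indicator_iff_restrict hUm]; exact hw.ae_eq hww'
  have hH'L : MemLp H' q volume := by
    rw [← hH'U, memLp_indicator_iff_restrict hUm]; exact hH.ae_eq hHH'
  have hweak : ∀ ψ : Euc (n + 1) → ℝ, ContDiff ℝ ∞ ψ → HasCompactSupport ψ →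
      ∫ x, w' x • gradient ψ x = - ∫ x, ψ x • H' x := by
    intro ψ hψ hψc
    have := integral_smul_gradient_extDomain_of_chart hq hΩ he hγ hB hchart hK hKB hf hfK hw hH
      hlim hlim' htrace hψ hψc
    have e1 : ∫ x, w' x • gradient ψ x = ∫ x in extDomain Ω, w x • gradient ψ x := by
      rw [← setIntegral_eq_integral_of_forall_compl_eq_zero (s := extDomain Ω) fun x hx => by
        rw [← hw'U, indicator_of_notMem hx, zero_smul]]
      refine integral_congr_ae ?_
      filter_upwards [hww'] with x hx
      rw [hx]
    have e2 : ∫ x, ψ x • H' x = ∫ x in extDomain Ω, ψ x • H x := by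
      rw [← setIntegral_eq_integral_of_forall_compl_eq_zero (s := extDomain Ω) fun x hx => by
        rw [← hH'U, indicator_of_notMem hx, smul_zero]]
      refine integral_congr_ae ?_
      filter_upwards [hHH'] with x hx
      rw [hx]
    rw [e1, e2, this]
  -- choice of the mollifier
  obtain ⟨δ₁, hδ₁, h₁⟩ := exists_eLpNorm_mollify_sub_le hq hq' hw'm hw'L hε
  obtain ⟨δ₂, hδ₂, h₂⟩ := exists_eLpNorm_mollify_sub_le hq hq' hH'm hH'L hε
  obtain ⟨δ₃, hδ₃, h₃⟩ := hK.exists_thickening_subset_open hB hKB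
  -- A shift by `-t • e` with error at most `c * t` raises the height by at most `(c * t - t) + L *
  -- c * t = -t / 2`, so it still takes nonpositive heights to negative ones.
  set c : ℝ := 1 / (2 * (1 + L)) with hc
  have hL0 : (0 : ℝ) ≤ L := L.2
  have hcpos : 0 < c := by positivity
  have hcL : c * (1 + L) = 1 / 2 := by rw [hc]; field_simp
  have hc1 : c ≤ 1 := by nlinarith
  -- Points of the kernel's support have norm at most `2 * t`, which must stay below all three
  -- radii: two for the `L^q` errors, one for remaining inside the chart.
  set t : ℝ := min δ₁ (min δ₂ δ₃) / 3 with ht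
  have htmin : 0 < min δ₁ (min δ₂ δ₃) := lt_min hδ₁ (lt_min hδ₂ hδ₃)
  have htpos : 0 < t := by positivity
  have ht1 : 2 * t < δ₁ := by have := min_le_left δ₁ (min δ₂ δ₃); rw [ht]; linarith
  have ht2 : 2 * t < δ₂ := by
    have := (min_le_right δ₁ (min δ₂ δ₃)).trans (min_le_left _ _); rw [ht]; linarith
  have ht3 : 2 * t < δ₃ := by
    have := (min_le_right δ₁ (min δ₂ δ₃)).trans (min_le_right _ _); rw [ht]; linarith
  -- The kernel is centred at `-(t • e)`, not at the origin, so that mollifying also pushes the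
  -- support away from `Ω`.
  let bump : ContDiffBump (-(t • e)) :=
    ⟨c * t / 2, c * t, by positivity, by have := mul_pos hcpos htpos; linarith⟩
  set ρ : Euc (n + 1) → ℝ := bump.normed volume with hρ
  have hρs : ContDiff ℝ ∞ ρ := bump.contDiff_normed
  have hρc : HasCompactSupport ρ := bump.hasCompactSupport_normed
  have hρball : ∀ z, ρ z ≠ 0 → ‖z + t • e‖ < c * t := by
    intro z hz
    have : z ∈ Function.support ρ := hz
    rw [hρ, bump.support_normed_eq, mem_ball_iff_norm, sub_neg_eq_add] at this
    exact this
  have hnorm : ∀ z, ‖z + t • e‖ ≤ c * t → ‖z‖ ≤ 2 * t := by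
    intro z hz
    have h := norm_sub_le (z + t • e) (t • e)
    rw [add_sub_cancel_right, norm_smul, he, Real.norm_of_nonneg htpos.le, mul_one] at h
    nlinarith
  obtain ⟨hφ, hgrad⟩ := contDiff_mollify_and_gradient (hw'L.locallyIntegrable hq)
    (hH'L.locallyIntegrable hq) hweak hρs hρc
  set φ : Euc (n + 1) → ℝ := fun x => ∫ z, ρ z • w' (x - z) with hφdef
  -- the support of the mollification
  set K' : Set (Euc (n + 1)) := K ∩ {y | graphHeight e γ y ≤ 0} with hK'
  have hK'c : IsCompact K' :=
    hK.inter_right (isClosed_le (continuous_graphHeight e hγ) continuous_const)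
  have hsumc : IsCompact (K' + Metric.closedBall (-(t • e)) (c * t)) :=
    hK'c.add (isCompact_closedBall _ _)
  have hsub : Function.support φ ⊆ K' + Metric.closedBall (-(t • e)) (c * t) := by
    intro x hx
    by_contra hxn
    refine hx (integral_eq_zero_of_ae (ae_of_all _ fun z => ?_))
    by_contra hz
    have hz1 : ρ z ≠ 0 := fun h => hz (by simp [h])
    have hz2 : w' (x - z) ≠ 0 := fun h => hz (by simp [h])
    have hz3 : x - z ∈ extDomain Ω ∩ K := by
      by_contra h
      exact hz2 (indicator_of_notMem h _)
    refine hxn ⟨x - z, ⟨hz3.2, ?_⟩, z, ?_, sub_add_cancel _ _⟩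
    · exact ((chart_frontier_and_extDomain hΩ he hγ hB hchart (hKB hz3.2)).2.1 hz3.1).le
    · rw [mem_closedBall_iff_norm, sub_neg_eq_add]
      exact (hρball z hz1).le
  have hsubU : K' + Metric.closedBall (-(t • e)) (c * t) ⊆ extDomain Ω := by
    rintro _ ⟨y, ⟨hyK, hy0⟩, z, hz, rfl⟩
    rw [mem_closedBall_iff_norm, sub_neg_eq_add] at hz
    have hyB : y + z ∈ B := by
      refine h₃ (Metric.mem_thickening_iff.2 ⟨y, hyK, ?_⟩)
      rw [dist_eq_norm, add_sub_cancel_left]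
      exact (hnorm z hz).trans_lt ht3
    refine (chart_frontier_and_extDomain hΩ he hγ hB hchart hyB).2.2 ?_
    have hup := (graphHeight_add_le e hγ y z).2
    have hy0 : graphHeight e γ y ≤ 0 := hy0
    have hee : ⟪e, e⟫ = (1 : ℝ) := by rw [real_inner_self_eq_norm_sq, he]; norm_num
    have hi : ⟪e, z⟫ ≤ c * t - t := by
      have h := real_inner_le_norm e (z + t • e)
      rw [inner_add_right, inner_smul_right, hee, he] at h
      linarith
    have hh : ‖z - ⟪e, z⟫ • e‖ ≤ c * t := by
      have h := norm_sub_inner_smul_le he (z + t • e)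
      rw [inner_add_right, inner_smul_right, hee, mul_one, add_smul, add_sub_add_right_eq_sub] at h
      exact h.trans hz
    have := mul_le_mul_of_nonneg_left hh hL0
    nlinarith
  have hts : tsupport φ ⊆ K' + Metric.closedBall (-(t • e)) (c * t) :=
    closure_minimal hsub hsumc.isClosed
  have hmono : ∀ {V : Type} [NormedAddCommGroup V] (g : Euc (n + 1) → V),
      eLpNorm g q (volume.restrict (extDomain Ω)) ≤ eLpNorm g q volume := fun g =>
    eLpNorm_mono_measure _ Measure.restrict_le_self
  refine ⟨φ, hφ, hsumc.of_isClosed_subset (isClosed_tsupport _) hts, hts.trans hsubU, ?_, ?_⟩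
  · have : eLpNorm (fun x => φ x - w x) q (volume.restrict (extDomain Ω)) =
        eLpNorm (fun x => φ x - w' x) q (volume.restrict (extDomain Ω)) := by
      refine eLpNorm_congr_ae ?_
      filter_upwards [hww'] with x hx
      rw [hx]
    rw [this]
    exact (hmono _).trans (h₁ ρ hρs.continuous hρc bump.nonneg_normed bump.integral_normed
      fun z hz => (hnorm z (hρball z hz).le).trans_lt ht1)
  · have : eLpNorm (fun x => gradient φ x - H x) q (volume.restrict (extDomain Ω)) =
        eLpNorm (fun x => (∫ z, ρ z • H' (x - z)) - H' x) q (volume.restrict (extDomain Ω)) := by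
      refine eLpNorm_congr_ae ?_
      filter_upwards [hHH'] with x hx
      rw [hx, hgrad]
    rw [this]
    exact (hmono _).trans (h₂ ρ hρs.continuous hρc bump.nonneg_normed bump.integral_normed
      fun z hz => (hnorm z (hρball z hz).le).trans_lt ht2)

/-! ### Localisation, partition of unity and gluing -/

/-- The common squeeze behind the product and composition limits below: a pointwise bound by two
error terms already known to tend to zero. When there is only one error term it is supplied twice.
-/
theorem tendsto_eLpNorm_zero_of_norm_le {α ι V V₁ V₂ : Type*} [MeasurableSpace α] {μ : Measure α}
    [NormedAddCommGroup V] [NormedAddCommGroup V₁] [NormedAddCommGroup V₂] {q : ℝ≥0∞} (hq : 1 ≤ q)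
    {l : Filter ι} {a : ι → α → V} {b : ι → α → V₁} {c : ι → α → V₂} (C : ℝ)
    (hb : ∀ k, AEStronglyMeasurable (b k) μ) (hc : ∀ k, AEStronglyMeasurable (c k) μ)
    (hbl : Tendsto (fun k => eLpNorm (b k) q μ) l (𝓝 0))
    (hcl : Tendsto (fun k => eLpNorm (c k) q μ) l (𝓝 0))
    (h : ∀ k, ∀ᵐ x ∂μ, ‖a k x‖ ≤ C * (‖b k x‖ + ‖c k x‖)) :
    Tendsto (fun k => eLpNorm (a k) q μ) l (𝓝 0) := by
  have hbound : ∀ k, eLpNorm (a k) q μ ≤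
      ENNReal.ofReal C * (eLpNorm (b k) q μ + eLpNorm (c k) q μ) := by
    intro k
    have h1 : eLpNorm (a k) q μ ≤ ENNReal.ofReal C * eLpNorm (fun x => ‖b k x‖ + ‖c k x‖) q μ := by
      refine eLpNorm_le_mul_eLpNorm_of_ae_le_mul ?_ _
      filter_upwards [h k] with x hx
      rwa [Real.norm_of_nonneg (by positivity : 0 ≤ ‖b k x‖ + ‖c k x‖)]
    refine h1.trans ?_
    gcongr
    refine (eLpNorm_add_le (hb k).norm (hc k).norm hq).trans_eq ?_
    rw [eLpNorm_norm, eLpNorm_norm]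
  refine tendsto_of_tendsto_of_tendsto_of_le_of_le tendsto_const_nhds ?_ (fun _ => zero_le) hbound
  simpa using ENNReal.Tendsto.const_mul (a := ENNReal.ofReal C) (hbl.add hcl)
    (Or.inr ENNReal.ofReal_ne_top)

section Multiply

variable {N : ℕ} {q : ℝ≥0∞} {μ : Measure (Euc N)} {f : ℕ → Euc N → ℝ} {w : Euc N → ℝ}
  {H : Euc N → Euc N} {ζ : Euc N → ℝ} {C : ℝ}

theorem tendsto_eLpNorm_mul_sub (hq : 1 ≤ q) (hf : ∀ k, ContDiff ℝ ∞ (f k))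
    (hw : AEStronglyMeasurable w μ) (hζC : ∀ x, ‖ζ x‖ ≤ C)
    (hlim : Tendsto (fun k => eLpNorm (fun x => f k x - w x) q μ) atTop (𝓝 0)) :
    Tendsto (fun k => eLpNorm (fun x => ζ x * f k x - ζ x * w x) q μ) atTop (𝓝 0) := by
  have hm : ∀ k, AEStronglyMeasurable (fun x => f k x - w x) μ := fun k =>
    (hf k).continuous.aestronglyMeasurable.sub hw
  refine tendsto_eLpNorm_zero_of_norm_le hq C hm hm hlim hlim fun k => ae_of_all _ fun x => ?_
  rw [← mul_sub, norm_mul]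
  have hC : 0 ≤ C := (norm_nonneg _).trans (hζC x)
  refine mul_le_mul (hζC x) ?_ (norm_nonneg _) hC
  linarith [norm_nonneg (f k x - w x)]

/-- By Leibniz' rule the error is `(f k - w) ∇ζ + ζ (∇f k - H)`, and both coefficients are bounded.
-/
theorem tendsto_eLpNorm_gradient_mul_sub (hq : 1 ≤ q) (hf : ∀ k, ContDiff ℝ ∞ (f k))
    (hw : AEStronglyMeasurable w μ) (hH : AEStronglyMeasurable H μ) (hζ : ContDiff ℝ ∞ ζ)
    (hζC : ∀ x, ‖ζ x‖ ≤ C) (hζC' : ∀ x, ‖gradient ζ x‖ ≤ C)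
    (hlim : Tendsto (fun k => eLpNorm (fun x => f k x - w x) q μ) atTop (𝓝 0))
    (hlim' : Tendsto (fun k => eLpNorm (fun x => gradient (f k) x - H x) q μ) atTop (𝓝 0)) :
    Tendsto (fun k => eLpNorm (fun x => gradient (fun y => ζ y * f k y) x -
      (ζ x • H x + w x • gradient ζ x)) q μ) atTop (𝓝 0) := by
  refine tendsto_eLpNorm_zero_of_norm_le hq C
    (b := fun k x => f k x - w x) (c := fun k x => gradient (f k) x - H x)
    (fun k => (hf k).continuous.aestronglyMeasurable.sub hw)
    (fun k => (continuous_gradient (contDiff_one_of_infty (hf k))).aestronglyMeasurable.sub hH)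
    hlim hlim' fun k => ae_of_all _ fun x => ?_
  rw [gradient_mul ((contDiff_one_of_infty hζ).differentiable one_ne_zero x)
    ((contDiff_one_of_infty (hf k)).differentiable one_ne_zero x)]
  have e : ζ x • gradient (f k) x + f k x • gradient ζ x - (ζ x • H x + w x • gradient ζ x) =
      (f k x - w x) • gradient ζ x + ζ x • (gradient (f k) x - H x) := by
    rw [sub_smul, smul_sub]; abel
  rw [e]
  refine (norm_add_le _ _).trans ?_
  rw [norm_smul, norm_smul, mul_add, mul_comm]
  gcongr
  · exact hζC' x
  · exact hζC x

theorem memLp_mul_and_gradient (hw : MemLp w q μ) (hH : MemLp H q μ) (hζ : ContDiff ℝ ∞ ζ)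
    (hζC : ∀ x, ‖ζ x‖ ≤ C) (hζC' : ∀ x, ‖gradient ζ x‖ ≤ C) :
    MemLp (fun x => ζ x * w x) q μ ∧ MemLp (fun x => ζ x • H x + w x • gradient ζ x) q μ := by
  have hg : AEStronglyMeasurable (gradient ζ) μ :=
    (continuous_gradient (contDiff_one_of_infty hζ)).aestronglyMeasurable
  have hζm : AEStronglyMeasurable ζ μ := hζ.continuous.aestronglyMeasurable
  refine ⟨hw.of_le_mul (c := C) (hζm.mul hw.1) (ae_of_all _ fun x => ?_),
    (hH.of_le_mul (c := C) (hζm.smul hH.1) (ae_of_all _ fun x => ?_)).add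
    (hw.of_le_mul (c := C) (hw.1.smul hg) (ae_of_all _ fun x => ?_))⟩
  · rw [norm_mul]; gcongr; exact hζC x
  · rw [Pi.smul_apply', norm_smul]; gcongr; exact hζC x
  · rw [norm_smul, mul_comm]; gcongr; exact hζC' x

end Multiply

section Approx

variable {N : ℕ} {q : ℝ≥0∞} {U : Set (Euc N)}

theorem smoothCompactApprox_zero : SmoothCompactApprox q U 0 0 := fun ε _ =>
  ⟨0, contDiff_const, HasCompactSupport.zero, by simp [tsupport], by simp, by
    have : ∀ x : Euc N, gradient (0 : Euc N → ℝ) x = 0 := fun x => by simp [gradient]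
    simp [this]⟩

theorem SmoothCompactApprox.add (hq : 1 ≤ q) {w₁ w₂ : Euc N → ℝ} {H₁ H₂ : Euc N → Euc N}
    (hw₁ : AEStronglyMeasurable w₁ (volume.restrict U))
    (hw₂ : AEStronglyMeasurable w₂ (volume.restrict U))
    (hH₁ : AEStronglyMeasurable H₁ (volume.restrict U))
    (hH₂ : AEStronglyMeasurable H₂ (volume.restrict U))
    (h₁ : SmoothCompactApprox q U w₁ H₁) (h₂ : SmoothCompactApprox q U w₂ H₂) :
    SmoothCompactApprox q U (fun x => w₁ x + w₂ x) (fun x => H₁ x + H₂ x) := by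
  intro ε hε
  have hε2 : ε / 2 ≠ 0 := by simp [hε]
  obtain ⟨ψ₁, s₁, c₁, t₁, a₁, b₁⟩ := h₁ _ hε2
  obtain ⟨ψ₂, s₂, c₂, t₂, a₂, b₂⟩ := h₂ _ hε2
  have s₁' := contDiff_one_of_infty s₁
  have s₂' := contDiff_one_of_infty s₂
  refine ⟨fun x => ψ₁ x + ψ₂ x, s₁.add s₂, c₁.add c₂,
    (tsupport_add ψ₁ ψ₂).trans (union_subset t₁ t₂), ?_, ?_⟩
  · have e : (fun x => ψ₁ x + ψ₂ x - (w₁ x + w₂ x)) =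
        (fun x => ψ₁ x - w₁ x) + fun x => ψ₂ x - w₂ x := by
      funext x; simp only [Pi.add_apply]; ring
    rw [e, ← ENNReal.add_halves ε]
    exact (eLpNorm_add_le (s₁.continuous.aestronglyMeasurable.sub hw₁)
      (s₂.continuous.aestronglyMeasurable.sub hw₂) hq).trans (add_le_add a₁ a₂)
  · have e : (fun x => gradient (fun x => ψ₁ x + ψ₂ x) x - (H₁ x + H₂ x)) =
        (fun x => gradient ψ₁ x - H₁ x) + fun x => gradient ψ₂ x - H₂ x := by
      funext x
      rw [gradient_add (s₁'.differentiable one_ne_zero x) (s₂'.differentiable one_ne_zero x)]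
      simp only [Pi.add_apply]; abel
    rw [e, ← ENNReal.add_halves ε]
    exact (eLpNorm_add_le ((continuous_gradient s₁').aestronglyMeasurable.sub hH₁)
      ((continuous_gradient s₂').aestronglyMeasurable.sub hH₂) hq).trans (add_le_add b₁ b₂)

theorem SmoothCompactApprox.sum (hq : 1 ≤ q) {ι : Type*} (s : Finset ι) {w : ι → Euc N → ℝ}
    {H : ι → Euc N → Euc N}
    (hw : ∀ i, AEStronglyMeasurable (w i) (volume.restrict U))
    (hH : ∀ i, AEStronglyMeasurable (H i) (volume.restrict U))
    (h : ∀ i, SmoothCompactApprox q U (w i) (H i)) :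
    SmoothCompactApprox q U (fun x => ∑ i ∈ s, w i x) (fun x => ∑ i ∈ s, H i x) := by
  classical
  induction s using Finset.induction_on with
  | empty => simpa only [Finset.sum_empty] using! (smoothCompactApprox_zero (q := q) (U := U))
  | insert i s hi ih =>
    simp only [Finset.sum_insert hi]
    exact (h i).add hq (hw i) (Finset.aestronglyMeasurable_fun_sum s fun j _ => hw j) (hH i)
      (Finset.aestronglyMeasurable_fun_sum s fun j _ => hH j) ih

/-- Limits of smooth compactly supported functions that vanish near the boundary. -/
theorem smoothCompactApprox_of_tsupport_disjoint_frontier (hU : IsOpen U) {f : ℕ → Euc N → ℝ}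
    (hf : ∀ k, ContDiff ℝ ∞ (f k)) (hfc : ∀ k, HasCompactSupport (f k))
    (hfU : ∀ k, Disjoint (tsupport (f k)) (frontier U))
    {w : Euc N → ℝ} {H : Euc N → Euc N}
    (hlim : Tendsto (fun k => eLpNorm (fun x => f k x - w x) q (volume.restrict U)) atTop (𝓝 0))
    (hlim' : Tendsto (fun k => eLpNorm (fun x => gradient (f k) x - H x) q (volume.restrict U))
      atTop (𝓝 0)) : SmoothCompactApprox q U w H := by
  intro ε hε
  obtain ⟨k, h1, h2⟩ := ((hlim.eventually (Iic_mem_nhds (pos_iff_ne_zero.2 hε))).and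
    (hlim'.eventually (Iic_mem_nhds (pos_iff_ne_zero.2 hε)))).exists
  -- The support may have parts on both sides of the boundary. As it misses the frontier, cutting to
  -- `U` creates no jump and changes nothing inside `U`.
  have hin : ∀ x ∈ U, indicator U (f k) =ᶠ[𝓝 x] f k := fun x hx => by
    filter_upwards [hU.mem_nhds hx] with y hy using indicator_of_mem hy _
  have hts : tsupport (indicator U (f k)) ⊆ tsupport (f k) ∩ closure U := by
    rw [tsupport, support_indicator, inter_comm]
    exact closure_inter_subset_inter_closure _ _
  have htsU : tsupport (indicator U (f k)) ⊆ U := by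
    intro x hx
    by_contra hxU
    exact disjoint_left.1 (hfU k) (hts hx).1 ⟨(hts hx).2, by rwa [hU.interior_eq]⟩
  refine ⟨indicator U (f k), ?_, (hfc k).of_isClosed_subset (isClosed_tsupport _)
    (hts.trans inter_subset_left), htsU, ?_, ?_⟩
  · rw [contDiff_iff_contDiffAt]
    intro x
    by_cases hx : x ∈ U
    · exact (hf k).contDiffAt.congr_of_eventuallyEq (hin x hx)
    · have : indicator U (f k) =ᶠ[𝓝 x] fun _ => 0 :=
        notMem_tsupport_iff_eventuallyEq.1 fun h => hx (htsU h)
      exact contDiffAt_const.congr_of_eventuallyEq this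
  · refine (eLpNorm_congr_ae ?_).trans_le h1
    filter_upwards [ae_restrict_mem hU.measurableSet] with x hx
    rw [indicator_of_mem hx]
  · refine (eLpNorm_congr_ae ?_).trans_le h2
    filter_upwards [ae_restrict_mem hU.measurableSet] with x hx
    rw [(hin x hx).gradient_eq]

end Approx

/-- A finite smooth partition of unity subordinate to neighbourhoods of the points of a compact
set and the complement of that set. -/
theorem exists_finite_smooth_partition {N : ℕ} {S : Set (Euc N)} (hS : IsCompact S)
    (r : Euc N → ℝ) (hr : ∀ x ∈ S, 0 < r x) :
    ∃ (t : Finset (Euc N)) (ζ : Option t → Euc N → ℝ) (C : ℝ),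
      (∀ x ∈ t, x ∈ S) ∧ (∀ i, ContDiff ℝ ∞ (ζ i)) ∧ (∀ i x, ‖ζ i x‖ ≤ C) ∧
      (∀ i x, ‖gradient (ζ i) x‖ ≤ C) ∧ (∀ x, ∑ i, ζ i x = 1) ∧
      (∀ x, ∑ i, gradient (ζ i) x = 0) ∧ Disjoint (tsupport (ζ none)) S ∧
      ∀ x : t, HasCompactSupport (ζ (some x)) ∧
        tsupport (ζ (some x)) ⊆ Metric.ball (x : Euc N) (r x) := by
  classical
  obtain ⟨t, htS, hcov⟩ := hS.elim_nhds_subcover (fun x => Metric.ball x (r x))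
    fun x hx => Metric.ball_mem_nhds x (hr x hx)
  let V : Option t → Set (Euc N) := fun i => i.elim Sᶜ fun x => Metric.ball (x : Euc N) (r x)
  obtain ⟨F, hF⟩ := SmoothPartitionOfUnity.exists_isSubordinate (modelWithCornersSelf ℝ (Euc N))
    (isClosed_univ (X := Euc N)) V
    (by rintro (_ | x); exacts [hS.isClosed.isOpen_compl, Metric.isOpen_ball])
    (by
      intro x _
      by_cases hx : x ∈ S
      · obtain ⟨y, hy, hxy⟩ := mem_iUnion₂.1 (hcov hx)
        exact mem_iUnion.2 ⟨some ⟨y, hy⟩, hxy⟩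
      · exact mem_iUnion.2 ⟨none, hx⟩)
  have hsmooth : ∀ i, ContDiff ℝ ∞ (F i) := fun i => (F i).contMDiff.contDiff
  have hdiff : ∀ i, Differentiable ℝ (F i) := fun i =>
    (contDiff_one_of_infty (hsmooth i)).differentiable one_ne_zero
  have hsum : ∀ x, ∑ i, F i x = 1 := fun x => by
    rw [← finsum_eq_sum_of_fintype]; exact F.sum_eq_one (mem_univ x)
  have hgsum : ∀ x, ∑ i, gradient (F i) x = 0 := by
    intro x
    refine ext_inner_right ℝ fun d => ?_
    have h0 : fderiv ℝ (fun y => ∑ i, F i y) x = 0 := by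
      rw [show (fun y => ∑ i, F i y) = fun _ => (1 : ℝ) from funext hsum]; simp
    rw [fderiv_fun_sum fun i _ => hdiff i x] at h0
    simp only [sum_inner, inner_gradient_left, inner_zero_left]
    have := congrArg (fun A : Euc N →L[ℝ] ℝ => A d) h0
    simpa using this
  have hcs : ∀ x : t, HasCompactSupport (F (some x)) := fun x =>
    (isCompact_closedBall (x : Euc N) (r x)).of_isClosed_subset (isClosed_tsupport _)
      ((hF (some x)).trans Metric.ball_subset_closedBall)
  choose D hD0 hD using fun x : t => (hcs x).gradient.exists_norm_le
    (continuous_gradient (contDiff_one_of_infty (hsmooth (some x))))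
  refine ⟨t, fun i => F i, 1 + ∑ x, D x, htS, hsmooth, fun i x => ?_, fun i x => ?_, hsum, hgsum,
    ?_, fun x => ⟨hcs x, hF (some x)⟩⟩
  · rw [Real.norm_of_nonneg (F.nonneg i x)]
    have := Finset.sum_nonneg fun x (_ : x ∈ Finset.univ) => hD0 x
    linarith [F.le_one i x]
  · rcases i with _ | y
    -- The piece `none` need not have compact support; its gradient is bounded because it is minus
    -- the sum of the gradients of the others.
    · have h := hgsum x
      rw [Fintype.sum_option] at h
      rw [eq_neg_of_add_eq_zero_left h, norm_neg]
      refine (norm_sum_le _ _).trans ?_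
      have := Finset.sum_le_sum fun y (_ : y ∈ Finset.univ) => hD y x
      linarith
    · have := Finset.single_le_sum (fun x (_ : x ∈ Finset.univ) => hD0 x) (Finset.mem_univ y)
      linarith [hD y x]
  · exact disjoint_left.2 fun x hx => hF none hx

theorem frontier_extDomain_subset {N : ℕ} (Ω : Set (Euc N)) :
    frontier (extDomain Ω) ⊆ frontier Ω := by
  rw [extDomain, frontier_compl]
  exact frontier_closure_subset

/-- A `W^{1,q}(Ωᵉ)` limit of smooth functions whose boundary values tend to zero belongs to the
closure of the smooth functions compactly supported in `Ωᵉ`. -/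
theorem smoothCompactApprox_of_trace_tendsto_zero {n : ℕ} {q : ℝ≥0∞} (hq : 1 ≤ q) (hq' : q ≠ ⊤)
    {Ω : Set (Euc (n + 1))} (hΩ : IsOpen Ω) (hΩb : Bornology.IsBounded Ω)
    (hΩl : HasLipschitzBoundary Ω)
    {f : ℕ → Euc (n + 1) → ℝ} (hf : ∀ k, ContDiff ℝ ∞ (f k)) (hfc : ∀ k, HasCompactSupport (f k))
    {w : Euc (n + 1) → ℝ} {H : Euc (n + 1) → Euc (n + 1)}
    (hw : MemLp w q (volume.restrict (extDomain Ω)))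
    (hH : MemLp H q (volume.restrict (extDomain Ω)))
    (hlim : Tendsto (fun k => eLpNorm (fun x => f k x - w x) q (volume.restrict (extDomain Ω)))
      atTop (𝓝 0))
    (hlim' : Tendsto (fun k => eLpNorm (fun x => gradient (f k) x - H x) q
      (volume.restrict (extDomain Ω))) atTop (𝓝 0))
    (htrace : Tendsto (fun k => eLpNorm (f k) q (surfaceMeasure Ω)) atTop (𝓝 0)) :
    SmoothCompactApprox q (extDomain Ω) w H := by
  have hUo : IsOpen (extDomain Ω) := isClosed_closure.isOpen_compl
  have hS : IsCompact (frontier Ω) :=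
    Metric.isCompact_of_isClosed_isBounded isClosed_frontier
      (hΩb.closure.subset frontier_subset_closure)
  choose! e γ L r he hγ hr hchart using hΩl
  obtain ⟨t, ζ, C, htS, hζ, hζC, hζC', hsum, hgsum, hnone, hsome⟩ :=
    exists_finite_smooth_partition hS r hr
  have hmem := fun i => memLp_mul_and_gradient hw hH (hζ i) (hζC i) (hζC' i)
  have hl := fun i => tendsto_eLpNorm_mul_sub hq hf hw.1 (hζC i) hlim
  have hl' := fun i => tendsto_eLpNorm_gradient_mul_sub hq hf hw.1 hH.1 (hζ i) (hζC i) (hζC' i)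
    hlim hlim'
  have key : ∀ i, SmoothCompactApprox q (extDomain Ω) (fun x => ζ i x * w x)
      (fun x => ζ i x • H x + w x • gradient (ζ i) x) := by
    rintro (_ | x)
    · refine smoothCompactApprox_of_tsupport_disjoint_frontier hUo (fun k => (hζ none).mul (hf k))
        (fun k => (hfc k).mul_left) (fun k => ?_) (hl none) (hl' none)
      exact hnone.mono (tsupport_mul_subset_left) (frontier_extDomain_subset Ω)
    · have hx := htS x x.2
      refine smoothCompactApprox_of_chart hq hq' hΩ (he x hx) (hγ x hx) Metric.isOpen_ball
        (fun y hy => ?_) (hsome x).1 (hsome x).2 (fun k => (hζ (some x)).mul (hf k))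
        (fun k => tsupport_mul_subset_left) (hmem _).1 (hmem _).2 (fun y hy => ?_) (fun y hy => ?_)
        (hl _) (hl' _) ?_
      · rw [hchart x hx y hy, graphHeight, sub_pos]
      · rw [image_eq_zero_of_notMem_tsupport hy, zero_mul]
      · have : gradient (ζ (some x)) y = 0 := by
          by_contra h
          exact hy (support_gradient_subset_tsupport _ h)
        rw [image_eq_zero_of_notMem_tsupport hy, this]; simp
      · refine tendsto_eLpNorm_zero_of_norm_le hq C (fun k => (hf k).continuous.aestronglyMeasurable)
          (fun k => (hf k).continuous.aestronglyMeasurable) htrace htrace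
          fun k => ae_of_all _ fun y => ?_
        rw [norm_mul]
        have hC : 0 ≤ C := (norm_nonneg _).trans (hζC (some x) y)
        refine mul_le_mul (hζC _ y) ?_ (norm_nonneg _) hC
        linarith [norm_nonneg (f k y)]
  -- Summing the pieces recovers `w` and `H`: the cutoffs add up to one and their gradients cancel.
  have := SmoothCompactApprox.sum hq Finset.univ (fun i => (hmem i).1.1) (fun i => (hmem i).2.1) key
  simpa only [Finset.sum_add_distrib, ← Finset.sum_mul, ← Finset.sum_smul, ← Finset.smul_sum, hsum,
    hgsum, one_mul, one_smul, smul_zero, add_zero] using this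

/-! ### The space `W₀^{1,p}` and Sobolev's inequality -/

theorem integral_smul_gradient_eq_neg {N : ℕ} {f ψ : Euc N → ℝ} (hf : ContDiff ℝ 1 f)
    (hfc : HasCompactSupport f) (hψ : ContDiff ℝ 1 ψ) (hψc : HasCompactSupport ψ) :
    ∫ x, f x • gradient ψ x = - ∫ x, ψ x • gradient f x := by
  have i1 : Integrable fun x => f x • gradient ψ x :=
    (hf.continuous.smul (continuous_gradient hψ)).integrable_of_hasCompactSupport hfc.smul_right
  have i2 : Integrable fun x => ψ x • gradient f x :=
    (hψ.continuous.smul (continuous_gradient hf)).integrable_of_hasCompactSupport hψc.smul_right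
  refine ext_inner_left ℝ fun d => ?_
  rw [inner_neg_right, ← integral_inner i1, ← integral_inner i2]
  simp only [inner_smul_right, inner_gradient_right, conj_trivial]
  rw [integral_mul_fderiv_eq_neg_fderiv_mul_of_integrable]
  · simp only [mul_comm]
  · have := i2.const_inner (𝕜 := ℝ) d
    simpa only [inner_smul_right, inner_gradient_right, conj_trivial, mul_comm] using this
  · have := i1.const_inner (𝕜 := ℝ) d
    simpa only [inner_smul_right, inner_gradient_right, conj_trivial] using this
  · exact (hf.continuous.mul hψ.continuous).integrable_of_hasCompactSupport hfc.mul_right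
  · exact fun x _ => hf.differentiable one_ne_zero x
  · exact fun x _ => hψ.differentiable one_ne_zero x

theorem SmoothCompactApprox.exists_seq {N : ℕ} {q : ℝ≥0∞} {U : Set (Euc N)} {w : Euc N → ℝ}
    {H : Euc N → Euc N} (h : SmoothCompactApprox q U w H) :
    ∃ ψ : ℕ → Euc N → ℝ,
      (∀ k, ContDiff ℝ ∞ (ψ k) ∧ HasCompactSupport (ψ k) ∧ tsupport (ψ k) ⊆ U) ∧
      Tendsto (fun k => eLpNorm (fun x => ψ k x - w x) q (volume.restrict U)) atTop (𝓝 0) ∧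
      Tendsto (fun k => eLpNorm (fun x => gradient (ψ k) x - H x) q (volume.restrict U))
        atTop (𝓝 0) := by
  choose ψ h1 h2 h3 h4 h5 using fun k : ℕ => h ((k : ℝ≥0∞)⁻¹) (by simp)
  have hz := ENNReal.tendsto_inv_nat_nhds_zero
  exact ⟨ψ, fun k => ⟨h1 k, h2 k, h3 k⟩,
    tendsto_of_tendsto_of_tendsto_of_le_of_le tendsto_const_nhds hz (fun _ => zero_le) h4,
    tendsto_of_tendsto_of_tendsto_of_le_of_le tendsto_const_nhds hz (fun _ => zero_le) h5⟩

/-- Integration by parts holds for the smooth approximants and passes to the limit by Hölder's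
inequality, so the limit field is automatically the weak gradient. -/
theorem SmoothCompactApprox.memW1pZero {N : ℕ} {p : ℝ} (hp : 1 < p) {U : Set (Euc N)}
    {w : Euc N → ℝ} {H : Euc N → Euc N}
    (hw : MemLp w (ENNReal.ofReal p) (volume.restrict U))
    (hH : MemLp H (ENNReal.ofReal p) (volume.restrict U))
    (h : SmoothCompactApprox (ENNReal.ofReal p) U w H) : MemW1pZero p U w H := by
  have hq : 1 ≤ ENNReal.ofReal p := by rw [ENNReal.one_le_ofReal]; exact hp.le
  obtain ⟨ψ, hψ, hl, hl'⟩ := h.exists_seq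
  refine ⟨hw, ⟨locallyIntegrableOn_of_locallyIntegrable_restrict (hw.locallyIntegrable hq),
    locallyIntegrableOn_of_locallyIntegrable_restrict (hH.locallyIntegrable hq), ?_⟩, hH,
    ψ, hψ, hl, hl'⟩
  intro η hη hηc hηU
  have hη1 := contDiff_one_of_infty hη
  have hψ1 := fun k => contDiff_one_of_infty (hψ k).1
  have hψL : ∀ k, MemLp (ψ k) (ENNReal.ofReal p) (volume.restrict U) := fun k =>
    ((hψ k).1.continuous.memLp_of_hasCompactSupport (hψ k).2.1).restrict _
  have hψL' : ∀ k, MemLp (gradient (ψ k)) (ENNReal.ofReal p) (volume.restrict U) := fun k =>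
    ((continuous_gradient (hψ1 k)).memLp_of_hasCompactSupport (hψ k).2.1.gradient).restrict _
  have : ENNReal.HolderConjugate (ENNReal.ofReal p) (ENNReal.ofReal p).conjExponent :=
    ENNReal.HolderConjugate.conjExponent hq
  have hηL : MemLp η (ENNReal.ofReal p).conjExponent (volume.restrict U) :=
    (hη.continuous.memLp_of_hasCompactSupport hηc).restrict _
  have hηL' : MemLp (gradient η) (ENNReal.ofReal p).conjExponent (volume.restrict U) :=
    ((continuous_gradient hη1).memLp_of_hasCompactSupport hηc.gradient).restrict _
  have hint : ∀ {g : Euc N → ℝ}, MemLp g (ENNReal.ofReal p) (volume.restrict U) →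
      Integrable (fun x => g x • gradient η x) (volume.restrict U) := fun {g} hg =>
    memLp_one_iff_integrable.1 (MemLp.smul (p := ENNReal.ofReal p)
      (q := (ENNReal.ofReal p).conjExponent) hηL' hg)
  have h2 := tendsto_integral_smul_of_tendsto_eLpNorm hq hηL hψL' hH hl'
  refine ext_inner_left ℝ fun d => ?_
  have h1 : Tendsto (fun k => ⟪d, ∫ x in U, ψ k x • gradient η x⟫) atTop
      (𝓝 ⟪d, ∫ x in U, w x • gradient η x⟫) := by
    simp only [← integral_inner (hint (hψL _)), ← integral_inner (hint hw), inner_smul_right,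
      inner_gradient_right, conj_trivial, mul_comm _ (fderiv ℝ η _ d)]
    refine tendsto_integral_smul_of_tendsto_eLpNorm hq ?_ hψL hw hl
    exact (((hη1.continuous_fderiv one_ne_zero).clm_apply continuous_const).memLp_of_hasCompactSupport
        (hηc.fderiv_apply ℝ d)).restrict _
  have h3 : ∀ k, ∫ x in U, ψ k x • gradient η x = - ∫ x in U, η x • gradient (ψ k) x := by
    intro k
    rw [setIntegral_eq_integral_of_forall_compl_eq_zero,
      setIntegral_eq_integral_of_forall_compl_eq_zero,
      integral_smul_gradient_eq_neg (hψ1 k) (hψ k).2.1 hη1 hηc]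
    · intro x hx
      rw [image_eq_zero_of_notMem_tsupport fun h => hx (hηU h), zero_smul]
    · intro x hx
      rw [image_eq_zero_of_notMem_tsupport fun h => hx ((hψ k).2.2 h), zero_smul]
  simp only [h3] at h1
  exact tendsto_nhds_unique h1 ((continuous_const.inner continuous_id).continuousAt.tendsto.comp
    (h2.neg))

/-- A function in `W₀^{1,p}` with `p < N` and zero gradient vanishes. -/
theorem MemW1pZero.ae_eq_zero_of_gradient_ae_eq_zero {N : ℕ} {p : ℝ} (hp : 1 < p) (hpN : p < N)
    {U : Set (Euc N)} {w : Euc N → ℝ} {H : Euc N → Euc N} (h : MemW1pZero p U w H)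
    (hH : H =ᵐ[volume.restrict U] 0) : w =ᵐ[volume.restrict U] 0 := by
  obtain ⟨ψ, hψ, hl, hl'⟩ := h.approx
  have hp0 : 0 < p := by linarith
  have hN0 : (0 : ℝ) < N := by linarith
  have hψ1 := fun k => contDiff_one_of_infty (hψ k).1
  have hm := fun k => (hψ k).1.continuous.aestronglyMeasurable (μ := volume.restrict U)
  have hq0 : ENNReal.ofReal p ≠ 0 := by simpa using hp0
  -- The Sobolev exponent, `1/r = 1/p - 1/N`; it is positive because `p < N`.
  set r : NNReal := (p.toNNReal⁻¹ - (N : NNReal)⁻¹)⁻¹ with hr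
  have hle : (N : NNReal)⁻¹ < p.toNNReal⁻¹ := by
    refine inv_strictAnti₀ (by simpa using hp0) ?_
    rw [← NNReal.coe_lt_coe, Real.coe_toNNReal _ hp0.le]; exact_mod_cast hpN
  have hr0 : 0 < r := by rw [hr]; exact inv_pos.2 (tsub_pos_of_lt hle)
  have hgrad : ∀ k, eLpNorm (fderiv ℝ (ψ k)) (p.toNNReal : ℝ≥0∞) volume =
      eLpNorm (fun x => gradient (ψ k) x - H x) (ENNReal.ofReal p) (volume.restrict U) := by
    intro k
    have hsupp : Function.support (fderiv ℝ (ψ k)) ⊆ U :=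
      (support_fderiv_subset ℝ).trans (hψ k).2.2
    rw [← eLpNorm_restrict_eq_of_support_subset (f := fderiv ℝ (ψ k)) hsupp]
    refine eLpNorm_congr_norm_ae ?_
    filter_upwards [hH] with x hx
    simp [hx, gradient]
  have hsob : ∀ k, eLpNorm (ψ k) (r : ℝ≥0∞) (volume.restrict U) ≤
      SNormLESNormFDerivOfEqConst ℝ (volume : Measure (Euc N)) p.toNNReal *
      eLpNorm (fun x => gradient (ψ k) x - H x) (ENNReal.ofReal p) (volume.restrict U) := by
    intro k
    rw [← hgrad k]
    refine (eLpNorm_mono_measure _ Measure.restrict_le_self).trans ?_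
    refine eLpNorm_le_eLpNorm_fderiv_of_eq volume (hψ1 k) (hψ k).2.1 ?_ ?_ ?_
    · simpa using hp.le
    · simpa using hN0
    · rw [hr, NNReal.coe_inv, inv_inv, NNReal.coe_sub hle.le]
      simp
  have h0 : Tendsto (fun k => eLpNorm (ψ k - 0) (r : ℝ≥0∞) (volume.restrict U)) atTop (𝓝 0) := by
    simp only [sub_zero]
    refine tendsto_of_tendsto_of_tendsto_of_le_of_le tendsto_const_nhds ?_
      (fun _ => zero_le) hsob
    simpa using ENNReal.Tendsto.const_mul hl' (Or.inr ENNReal.coe_ne_top)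
  -- The approximants tend to `w` in `L^p` and, by Sobolev's inequality, to zero in `L^r`. The
  -- exponents differ, so the limits are compared in measure.
  refine tendstoInMeasure_ae_unique
    (tendstoInMeasure_of_tendsto_eLpNorm hq0 hm h.memLp.1 hl)
    (tendstoInMeasure_of_tendsto_eLpNorm (by simpa using hr0.ne') hm
      aestronglyMeasurable_zero h0)

/-! ### Nonlinear test functions and their admissibility -/

/-- Multiplication by bounded functions converging almost everywhere is continuous in `L^q`. -/
theorem tendsto_eLpNorm_smul_sub_of_tendsto_ae {α V : Type*} [MeasurableSpace α] {μ : Measure α}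
    [NormedAddCommGroup V] [NormedSpace ℝ V] {q : ℝ≥0∞} (hq : 1 ≤ q) (hq' : q ≠ ⊤)
    {a : ℕ → α → ℝ} {a' : α → ℝ} {Z : ℕ → α → V} {Z' : α → V} {C : ℝ}
    (ha : ∀ k, AEStronglyMeasurable (a k) μ) (haC : ∀ k x, ‖a k x‖ ≤ C)
    (ha' : ∀ᵐ x ∂μ, Tendsto (fun k => a k x) atTop (𝓝 (a' x)))
    (hZ : ∀ k, AEStronglyMeasurable (Z k) μ) (hZ' : MemLp Z' q μ)
    (hlim : Tendsto (fun k => eLpNorm (fun x => Z k x - Z' x) q μ) atTop (𝓝 0)) :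
    Tendsto (fun k => eLpNorm (fun x => a k x • Z k x - a' x • Z' x) q μ) atTop (𝓝 0) := by
  have hq0 : q ≠ 0 := (zero_lt_one.trans_le hq).ne'
  have hqr : 0 < q.toReal := ENNReal.toReal_pos hq0 hq'
  have ham : AEStronglyMeasurable a' μ := aestronglyMeasurable_of_tendsto_ae _ ha ha'
  have haC' : ∀ᵐ x ∂μ, ‖a' x‖ ≤ C := by
    filter_upwards [ha'] with x hx
    exact le_of_tendsto hx.norm (Eventually.of_forall fun k => haC k x)
  -- With the fixed factor `Z'`, dominated convergence applies with majorant `(2 C ‖Z'‖)^q`; the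
  -- remaining error `a k (Z k - Z')` is controlled by the uniform bound on `a k`.
  have h1 : Tendsto (fun k => eLpNorm (fun x => (a k x - a' x) • Z' x) q μ) atTop (𝓝 0) := by
    simp only [eLpNorm_eq_lintegral_rpow_enorm_toReal hq0 hq']
    have h0 : Tendsto (fun k => ∫⁻ x, ‖(a k x - a' x) • Z' x‖ₑ ^ q.toReal ∂μ) atTop
        (𝓝 (∫⁻ _, 0 ∂μ)) := by
      refine tendsto_lintegral_of_dominated_convergence'
        (fun x => (ENNReal.ofReal (2 * C) * ‖Z' x‖ₑ) ^ q.toReal) (fun k => ?_) (fun k => ?_) ?_ ?_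
      · exact (((ha k).sub ham).smul hZ'.1).enorm.pow_const _
      · filter_upwards [haC'] with x hx
        rw [enorm_smul]
        gcongr
        rw [← ofReal_norm]
        refine ENNReal.ofReal_le_ofReal ((norm_sub_le _ _).trans ?_)
        linarith [haC k x]
      · simp only [ENNReal.mul_rpow_of_nonneg _ _ hqr.le]
        rw [lintegral_const_mul'' _ (hZ'.1.enorm.pow_const _)]
        exact ENNReal.mul_ne_top (ENNReal.rpow_ne_top_of_nonneg hqr.le ENNReal.ofReal_ne_top)
          (lintegral_rpow_enorm_lt_top_of_eLpNorm_lt_top hq0 hq' hZ'.2).ne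
      · filter_upwards [ha'] with x hx
        have : Tendsto (fun k => (a k x - a' x) • Z' x) atTop (𝓝 0) := by
          simpa using (hx.sub_const (a' x)).smul_const (Z' x)
        have := (ENNReal.continuous_rpow_const (y := q.toReal)).continuousAt.tendsto.comp
          ((continuous_enorm.tendsto _).comp this)
        simpa [Function.comp_def, hqr] using this
    have := (ENNReal.continuous_rpow_const (y := 1 / q.toReal)).continuousAt.tendsto.comp h0
    simpa [Function.comp_def, hqr] using this
  refine tendsto_eLpNorm_zero_of_norm_le hq (max C 1) (fun k => (hZ k).sub hZ'.1)
    (fun k => ((ha k).sub ham).smul hZ'.1) hlim h1 fun k => ae_of_all _ fun x => ?_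
  have e : a k x • Z k x - a' x • Z' x = a k x • (Z k x - Z' x) + (a k x - a' x) • Z' x := by
    rw [smul_sub, sub_smul]; abel
  rw [e, mul_add]
  refine (norm_add_le _ _).trans (add_le_add ?_ ?_)
  · rw [norm_smul]
    exact mul_le_mul ((haC k x).trans (le_max_left _ _)) le_rfl (norm_nonneg _)
      (zero_le_one.trans (le_max_right _ _))
  · exact le_mul_of_one_le_left (norm_nonneg _) (le_max_right _ _)

theorem norm_sub_le_of_norm_deriv_le {β : ℝ → ℝ} {C : ℝ} (hβ : Differentiable ℝ β)
    (hC : ∀ t, ‖deriv β t‖ ≤ C) (s t : ℝ) : ‖β s - β t‖ ≤ C * ‖s - t‖ :=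
  convex_univ.norm_image_sub_le_of_norm_deriv_le (fun x _ => hβ x) (fun x _ => hC x)
    (mem_univ t) (mem_univ s)

section Composition

variable {N : ℕ}

/-- The test function `β(u₁ - u₂) g(u₁)`. -/
def testFun (β g : ℝ → ℝ) (u₁ u₂ : Euc N → ℝ) (x : Euc N) : ℝ :=
  β (u₁ x - u₂ x) * g (u₁ x)

/-- The gradient of `β(u₁ - u₂) g(u₁)` in terms of the gradients of `u₁` and `u₂`. -/
def testFunGrad (β g : ℝ → ℝ) (u₁ u₂ : Euc N → ℝ) (G₁ G₂ : Euc N → Euc N) (x : Euc N) : Euc N :=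
  (deriv β (u₁ x - u₂ x) * g (u₁ x)) • (G₁ x - G₂ x) +
    (β (u₁ x - u₂ x) * deriv g (u₁ x)) • G₁ x

/-- Smooth functions that are bounded along with their derivatives. -/
structure SmoothBounded (C : ℝ) (β : ℝ → ℝ) : Prop where
  contDiff : ContDiff ℝ ∞ β
  norm_le : ∀ t, ‖β t‖ ≤ C
  norm_deriv_le : ∀ t, ‖deriv β t‖ ≤ C

theorem SmoothBounded.nonneg {C : ℝ} {β : ℝ → ℝ} (hβ : SmoothBounded C β) : 0 ≤ C :=
  (norm_nonneg _).trans (hβ.norm_le 0)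

theorem SmoothBounded.differentiable {C : ℝ} {β : ℝ → ℝ} (hβ : SmoothBounded C β) :
    Differentiable ℝ β := (contDiff_one_of_infty hβ.contDiff).differentiable one_ne_zero

theorem SmoothBounded.continuous_deriv {C : ℝ} {β : ℝ → ℝ} (hβ : SmoothBounded C β) :
    Continuous (deriv β) := (contDiff_one_of_infty hβ.contDiff).continuous_deriv le_rfl

variable {β g : ℝ → ℝ} {C : ℝ}

theorem contDiff_testFun (hβ : SmoothBounded C β) (hg : SmoothBounded C g) {f₁ f₂ : Euc N → ℝ}
    (hf₁ : ContDiff ℝ ∞ f₁) (hf₂ : ContDiff ℝ ∞ f₂) : ContDiff ℝ ∞ (testFun β g f₁ f₂) :=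
  (hβ.contDiff.comp (hf₁.sub hf₂)).mul (hg.contDiff.comp hf₁)

theorem gradient_testFun (hβ : SmoothBounded C β) (hg : SmoothBounded C g) {f₁ f₂ : Euc N → ℝ}
    (hf₁ : ContDiff ℝ ∞ f₁) (hf₂ : ContDiff ℝ ∞ f₂) (x : Euc N) :
    gradient (testFun β g f₁ f₂) x = testFunGrad β g f₁ f₂ (gradient f₁) (gradient f₂) x := by
  have d₁ := (contDiff_one_of_infty hf₁).differentiable one_ne_zero
  have d₂ := (contDiff_one_of_infty hf₂).differentiable one_ne_zero
  have e₁ : gradient (fun x => β (f₁ x - f₂ x)) x =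
      deriv β (f₁ x - f₂ x) • (gradient f₁ x - gradient f₂ x) := by
    rw [gradient_comp_real (f := fun x => f₁ x - f₂ x) (hβ.differentiable _) ((d₁ x).sub (d₂ x)),
      gradient_sub (d₁ x) (d₂ x)]
  have e₂ : gradient (fun x => g (f₁ x)) x = deriv g (f₁ x) • gradient f₁ x :=
    gradient_comp_real (hg.differentiable _) (d₁ x)
  unfold testFun testFunGrad
  rw [gradient_mul (f := fun x => β (f₁ x - f₂ x)) (g := fun x => g (f₁ x)) ((hβ.differentiable _).comp x ((d₁ x).sub (d₂ x)))
    ((hg.differentiable _).comp x (d₁ x)), e₁, e₂, smul_smul, smul_smul,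
    mul_comm (deriv β _), add_comm]

variable {q : ℝ≥0∞} {μ : Measure (Euc N)} {u₁ u₂ : Euc N → ℝ} {G₁ G₂ : Euc N → Euc N}

theorem aestronglyMeasurable_testFun (hβ : SmoothBounded C β) (hg : SmoothBounded C g)
    (hu₁ : AEStronglyMeasurable u₁ μ) (hu₂ : AEStronglyMeasurable u₂ μ) :
    AEStronglyMeasurable (testFun β g u₁ u₂) μ :=
  (hβ.contDiff.continuous.comp_aestronglyMeasurable (hu₁.sub hu₂)).mul
    (hg.contDiff.continuous.comp_aestronglyMeasurable hu₁)

theorem norm_testFun_le (hβ : SmoothBounded C β) (hg : SmoothBounded C g) (x : Euc N) :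
    ‖testFun β g u₁ u₂ x‖ ≤ C * C := by
  rw [testFun, norm_mul]
  exact mul_le_mul (hβ.norm_le _) (hg.norm_le _) (norm_nonneg _) hβ.nonneg

theorem memLp_testFunGrad (hβ : SmoothBounded C β) (hg : SmoothBounded C g)
    (hu₁ : AEStronglyMeasurable u₁ μ) (hu₂ : AEStronglyMeasurable u₂ μ)
    (hG₁ : MemLp G₁ q μ) (hG₂ : MemLp G₂ q μ) :
    MemLp (testFunGrad β g u₁ u₂ G₁ G₂) q μ := by
  refine MemLp.add (((hG₁.sub hG₂).of_le_mul (c := C * C) ?_ (ae_of_all _ fun x => ?_)))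
    (hG₁.of_le_mul (c := C * C) ?_ (ae_of_all _ fun x => ?_))
  · exact ((hβ.continuous_deriv.comp_aestronglyMeasurable (hu₁.sub hu₂)).mul
      (hg.contDiff.continuous.comp_aestronglyMeasurable hu₁)).smul (hG₁.1.sub hG₂.1)
  · rw [norm_smul, norm_mul, Pi.sub_apply]
    exact mul_le_mul_of_nonneg_right (mul_le_mul (hβ.norm_deriv_le _) (hg.norm_le _)
      (norm_nonneg _) hβ.nonneg) (norm_nonneg _)
  · exact ((hβ.contDiff.continuous.comp_aestronglyMeasurable (hu₁.sub hu₂)).mul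
      (hg.continuous_deriv.comp_aestronglyMeasurable hu₁)).smul hG₁.1
  · rw [norm_smul, norm_mul]
    exact mul_le_mul_of_nonneg_right (mul_le_mul (hβ.norm_le _) (hg.norm_deriv_le _)
      (norm_nonneg _) hβ.nonneg) (norm_nonneg _)

/-- Bounded Lipschitz profiles make the product Lipschitz in the pair of functions, so `L^q`
convergence suffices here. -/
theorem tendsto_eLpNorm_testFun_sub (hq : 1 ≤ q) (hβ : SmoothBounded C β) (hg : SmoothBounded C g)
    {f₁ f₂ : ℕ → Euc N → ℝ} (hf₁ : ∀ k, AEStronglyMeasurable (f₁ k) μ)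
    (hf₂ : ∀ k, AEStronglyMeasurable (f₂ k) μ)
    (hu₁ : AEStronglyMeasurable u₁ μ) (hu₂ : AEStronglyMeasurable u₂ μ)
    (h₁ : Tendsto (fun k => eLpNorm (fun x => f₁ k x - u₁ x) q μ) atTop (𝓝 0))
    (h₂ : Tendsto (fun k => eLpNorm (fun x => f₂ k x - u₂ x) q μ) atTop (𝓝 0)) :
    Tendsto (fun k => eLpNorm (fun x => testFun β g (f₁ k) (f₂ k) x - testFun β g u₁ u₂ x) q μ)
      atTop (𝓝 0) := by
  refine tendsto_eLpNorm_zero_of_norm_le hq (2 * (C * C)) (fun k => (hf₁ k).sub hu₁)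
    (fun k => (hf₂ k).sub hu₂) h₁ h₂ fun k => ae_of_all _ fun x => ?_
  have hC := hβ.nonneg
  have e : testFun β g (f₁ k) (f₂ k) x - testFun β g u₁ u₂ x =
      (β (f₁ k x - f₂ k x) - β (u₁ x - u₂ x)) * g (f₁ k x) +
        β (u₁ x - u₂ x) * (g (f₁ k x) - g (u₁ x)) := by unfold testFun; ring
  have b1 := norm_sub_le_of_norm_deriv_le hβ.differentiable hβ.norm_deriv_le
    (f₁ k x - f₂ k x) (u₁ x - u₂ x)
  have b2 := norm_sub_le_of_norm_deriv_le hg.differentiable hg.norm_deriv_le (f₁ k x) (u₁ x)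
  have b3 : ‖f₁ k x - f₂ k x - (u₁ x - u₂ x)‖ ≤ ‖f₁ k x - u₁ x‖ + ‖f₂ k x - u₂ x‖ := by
    rw [show f₁ k x - f₂ k x - (u₁ x - u₂ x) = (f₁ k x - u₁ x) - (f₂ k x - u₂ x) by ring]
    exact norm_sub_le _ _
  rw [e]
  refine (norm_add_le _ _).trans ?_
  rw [norm_mul, norm_mul, Pi.sub_apply, Pi.sub_apply]
  have b1' := b1.trans (mul_le_mul_of_nonneg_left b3 hC)
  have t1 := mul_le_mul b1' (hg.norm_le (f₁ k x)) (norm_nonneg _) (by positivity)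
  have t2 := mul_le_mul (hβ.norm_le (u₁ x - u₂ x)) b2 (norm_nonneg _) hC
  have : 0 ≤ C * C * ‖f₂ k x - u₂ x‖ := by positivity
  nlinarith

/-- The coefficients involve `β'` and `g'`, about which only continuity and boundedness are used.
Hence almost everywhere convergence of the functions is required, in addition to `L^q` convergence
of the gradients. -/
theorem tendsto_eLpNorm_testFunGrad_sub (hq : 1 ≤ q) (hq' : q ≠ ⊤) (hβ : SmoothBounded C β)
    (hg : SmoothBounded C g) {f₁ f₂ : ℕ → Euc N → ℝ} {Z₁ Z₂ : ℕ → Euc N → Euc N}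
    (hf₁ : ∀ k, AEStronglyMeasurable (f₁ k) μ) (hf₂ : ∀ k, AEStronglyMeasurable (f₂ k) μ)
    (hZ₁ : ∀ k, AEStronglyMeasurable (Z₁ k) μ) (hZ₂ : ∀ k, AEStronglyMeasurable (Z₂ k) μ)
    (hG₁ : MemLp G₁ q μ) (hG₂ : MemLp G₂ q μ)
    (ha₁ : ∀ᵐ x ∂μ, Tendsto (fun k => f₁ k x) atTop (𝓝 (u₁ x)))
    (ha₂ : ∀ᵐ x ∂μ, Tendsto (fun k => f₂ k x) atTop (𝓝 (u₂ x)))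
    (h₁ : Tendsto (fun k => eLpNorm (fun x => Z₁ k x - G₁ x) q μ) atTop (𝓝 0))
    (h₂ : Tendsto (fun k => eLpNorm (fun x => Z₂ k x - G₂ x) q μ) atTop (𝓝 0)) :
    Tendsto (fun k => eLpNorm (fun x => testFunGrad β g (f₁ k) (f₂ k) (Z₁ k) (Z₂ k) x -
      testFunGrad β g u₁ u₂ G₁ G₂ x) q μ) atTop (𝓝 0) := by
  have hC := hβ.nonneg
  have hZ : Tendsto (fun k => eLpNorm (fun x => (Z₁ k x - Z₂ k x) - (G₁ x - G₂ x)) q μ)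
      atTop (𝓝 0) := by
    refine tendsto_eLpNorm_zero_of_norm_le hq 1 (fun k => (hZ₁ k).sub hG₁.1)
      (fun k => (hZ₂ k).sub hG₂.1) h₁ h₂ fun k => ae_of_all _ fun x => ?_
    rw [one_mul, Pi.sub_apply, Pi.sub_apply, sub_sub_sub_comm]
    exact norm_sub_le _ _
  have m1 : ∀ k, AEStronglyMeasurable
      (fun x => deriv β (f₁ k x - f₂ k x) * g (f₁ k x)) μ := fun k =>
    (hβ.continuous_deriv.comp_aestronglyMeasurable ((hf₁ k).sub (hf₂ k))).mul
      (hg.contDiff.continuous.comp_aestronglyMeasurable (hf₁ k))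
  have m2 : ∀ k, AEStronglyMeasurable
      (fun x => β (f₁ k x - f₂ k x) * deriv g (f₁ k x)) μ := fun k =>
    (hβ.contDiff.continuous.comp_aestronglyMeasurable ((hf₁ k).sub (hf₂ k))).mul
      (hg.continuous_deriv.comp_aestronglyMeasurable (hf₁ k))
  have t1 := tendsto_eLpNorm_smul_sub_of_tendsto_ae hq hq' (C := C * C) m1
    (fun k x => by
      rw [norm_mul]
      exact mul_le_mul (hβ.norm_deriv_le _) (hg.norm_le _) (norm_nonneg _) hC)
    (a' := fun x => deriv β (u₁ x - u₂ x) * g (u₁ x))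
    (by
      filter_upwards [ha₁, ha₂] with x hx₁ hx₂
      exact ((hβ.continuous_deriv.tendsto _).comp (hx₁.sub hx₂)).mul
        ((hg.contDiff.continuous.tendsto _).comp hx₁))
    (fun k => (hZ₁ k).sub (hZ₂ k)) (hG₁.sub hG₂) hZ
  have t2 := tendsto_eLpNorm_smul_sub_of_tendsto_ae hq hq' (C := C * C) m2
    (fun k x => by
      rw [norm_mul]
      exact mul_le_mul (hβ.norm_le _) (hg.norm_deriv_le _) (norm_nonneg _) hC)
    (a' := fun x => β (u₁ x - u₂ x) * deriv g (u₁ x))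
    (by
      filter_upwards [ha₁, ha₂] with x hx₁ hx₂
      exact ((hβ.contDiff.continuous.tendsto _).comp (hx₁.sub hx₂)).mul
        ((hg.continuous_deriv.tendsto _).comp hx₁))
    hZ₁ hG₁ h₁
  have ham₁ : AEStronglyMeasurable u₁ μ := aestronglyMeasurable_of_tendsto_ae _ hf₁ ha₁
  have ham₂ : AEStronglyMeasurable u₂ μ := aestronglyMeasurable_of_tendsto_ae _ hf₂ ha₂
  have m1' : AEStronglyMeasurable (fun x => deriv β (u₁ x - u₂ x) * g (u₁ x)) μ :=
    (hβ.continuous_deriv.comp_aestronglyMeasurable (ham₁.sub ham₂)).mul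
      (hg.contDiff.continuous.comp_aestronglyMeasurable ham₁)
  have m2' : AEStronglyMeasurable (fun x => β (u₁ x - u₂ x) * deriv g (u₁ x)) μ :=
    (hβ.contDiff.continuous.comp_aestronglyMeasurable (ham₁.sub ham₂)).mul
      (hg.continuous_deriv.comp_aestronglyMeasurable ham₁)
  refine tendsto_eLpNorm_zero_of_norm_le hq 1
    (fun k => ((m1 k).smul ((hZ₁ k).sub (hZ₂ k))).sub (m1'.smul (hG₁.1.sub hG₂.1)))
    (fun k => ((m2 k).smul (hZ₁ k)).sub (m2'.smul hG₁.1)) t1 t2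
    fun k => ae_of_all _ fun x => ?_
  · rw [one_mul]
    unfold testFunGrad
    rw [add_sub_add_comm]
    exact norm_add_le _ _

end Composition

theorem eLpNorm_restrict_eq_of_support_subset_ball {N : ℕ} {V : Type*} [NormedAddCommGroup V]
    {U : Set (Euc N)} {R : ℝ} {q : ℝ≥0∞} {f : Euc N → V}
    (hf : Function.support f ⊆ Metric.ball 0 R) :
    eLpNorm f q (volume.restrict U) = eLpNorm f q (volume.restrict (U ∩ Metric.ball 0 R)) := by
  rw [← eLpNorm_restrict_eq_of_support_subset hf, Measure.restrict_restrict measurableSet_ball,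
    inter_comm]

theorem memLp_restrict_of_support_subset_ball {N : ℕ} {V : Type*} [NormedAddCommGroup V]
    {U : Set (Euc N)} {R : ℝ} {q : ℝ≥0∞} {f : Euc N → V}
    (hf : Function.support f ⊆ Metric.ball 0 R)
    (h : MemLp f q (volume.restrict (U ∩ Metric.ball 0 R))) : MemLp f q (volume.restrict U) := by
  have e : f = indicator (Metric.ball 0 R) f := (indicator_eq_self.2 hf).symm
  rw [e, memLp_indicator_iff_restrict measurableSet_ball,
    Measure.restrict_restrict measurableSet_ball, inter_comm]
  exact h

theorem SmoothCompactApprox.congr {N : ℕ} {q : ℝ≥0∞} {U : Set (Euc N)} {w w' : Euc N → ℝ}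
    {H H' : Euc N → Euc N} (h : SmoothCompactApprox q U w H) (hw : w =ᵐ[volume.restrict U] w')
    (hH : H =ᵐ[volume.restrict U] H') : SmoothCompactApprox q U w' H' := by
  intro ε hε
  obtain ⟨ψ, h1, h2, h3, h4, h5⟩ := h ε hε
  refine ⟨ψ, h1, h2, h3, (eLpNorm_congr_ae ?_).trans_le h4, (eLpNorm_congr_ae ?_).trans_le h5⟩
  · filter_upwards [hw] with x hx using by rw [hx]
  · filter_upwards [hH] with x hx using by rw [hx]

theorem deriv_eq_zero_of_eq_zero_of_le {β : ℝ → ℝ} {ε t : ℝ} (hβ : ∀ s ≤ ε, β s = 0)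
    (ht : t < ε) : deriv β t = 0 := by
  have : β =ᶠ[𝓝 t] fun _ => 0 := by
    filter_upwards [Iio_mem_nhds ht] with s hs using hβ s (le_of_lt hs)
  rw [this.deriv_eq, deriv_const]

/-- If `u₁ ≤ u₂` on the boundary and both vanish at infinity, then `β(u₁ - u₂) g(u₁)` is an
admissible test function whenever `β` vanishes on `(-∞, ε]`, `ε > 0`. -/
theorem memW1pZero_testFun {n : ℕ} {p : ℝ} (hp : 1 < p) {Ω : Set (Euc (n + 1))} (hΩ : IsOpen Ω)
    (hΩb : Bornology.IsBounded Ω) (hΩl : HasLipschitzBoundary Ω)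
    {φ₁ φ₂ u₁ u₂ : Euc (n + 1) → ℝ} {G₁ G₂ : Euc (n + 1) → Euc (n + 1)}
    (hφ₁ : AEStronglyMeasurable φ₁ (surfaceMeasure Ω))
    (hφ₂ : AEStronglyMeasurable φ₂ (surfaceMeasure Ω))
    (hφ : ∀ᵐ x ∂(surfaceMeasure Ω), φ₁ x ≤ φ₂ x)
    (hu₁ : AEStronglyMeasurable u₁ (volume.restrict (extDomain Ω)))
    (hu₂ : AEStronglyMeasurable u₂ (volume.restrict (extDomain Ω)))
    (hG₁ : MemLp G₁ (ENNReal.ofReal p) (volume.restrict (extDomain Ω)))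
    (hG₂ : MemLp G₂ (ENNReal.ofReal p) (volume.restrict (extDomain Ω)))
    (hT₁ : HasTrace p Ω u₁ G₁ φ₁) (hT₂ : HasTrace p Ω u₂ G₂ φ₂)
    (hv₁ : VanishesAtInfinity Ω u₁) (hv₂ : VanishesAtInfinity Ω u₂)
    {β g : ℝ → ℝ} {C ε : ℝ} (hβ : SmoothBounded C β) (hg : SmoothBounded C g) (hε : 0 < ε)
    (hβ0 : ∀ t ≤ ε, β t = 0) :
    MemW1pZero p (extDomain Ω) (testFun β g u₁ u₂) (testFunGrad β g u₁ u₂ G₁ G₂) := by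
  set q := ENNReal.ofReal p with hqdef
  have hq : 1 ≤ q := by rw [hqdef, ENNReal.one_le_ofReal]; exact hp.le
  have hq' : q ≠ ⊤ := ENNReal.ofReal_ne_top
  have hq0 : q ≠ 0 := (zero_lt_one.trans_le hq).ne'
  have hC := hβ.nonneg
  have hUo : IsOpen (extDomain Ω) := isClosed_closure.isOpen_compl
  -- Two halves of `ε` make `u₁ - u₂ < ε` far out, where `β` therefore vanishes.
  obtain ⟨R₁, hR₁⟩ := hv₁ (ε / 2) (by positivity)
  obtain ⟨R₂, hR₂⟩ := hv₂ (ε / 2) (by positivity)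
  set R₀ := max 0 (max R₁ R₂) with hR₀
  have hR₀0 : 0 ≤ R₀ := le_max_left _ _
  have hR₀1 : R₁ ≤ R₀ := (le_max_left _ _).trans (le_max_right _ _)
  have hR₀2 : R₂ ≤ R₀ := (le_max_right _ _).trans (le_max_right _ _)
  -- The trace approximations converge only on bounded parts, hence the cutoff. It equals one on a
  -- neighbourhood of the ball of radius `R₀`, outside which the test function is zero, so it can be
  -- removed at the end.
  let χ : ContDiffBump (0 : Euc (n + 1)) := ⟨R₀ + 1, R₀ + 2, by linarith, by linarith⟩
  set R := R₀ + 3 with hR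
  have hχR : tsupport χ ⊆ Metric.ball 0 R := by
    rw [χ.tsupport_eq]
    exact Metric.closedBall_subset_ball (by change R₀ + 2 < R; linarith)
  have hχs : ContDiff ℝ ∞ χ := χ.contDiff
  obtain ⟨D, hD0, hD⟩ := χ.hasCompactSupport.gradient.exists_norm_le
    (continuous_gradient (contDiff_one_of_infty hχs))
  have hχD : ∀ x, ‖χ x‖ ≤ max D 1 := fun x => by
    rw [Real.norm_of_nonneg χ.nonneg]; exact χ.le_one.trans (le_max_right _ _)
  have hχD' : ∀ x, ‖gradient χ x‖ ≤ max D 1 := fun x => (hD x).trans (le_max_left _ _)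
  set μ : Measure (Euc (n + 1)) := volume.restrict (extDomain Ω ∩ Metric.ball 0 R) with hμ
  have hμle : μ ≤ volume.restrict (extDomain Ω) := Measure.restrict_mono inter_subset_left le_rfl
  have : IsFiniteMeasure μ := ⟨by
    rw [hμ, Measure.restrict_apply_univ]
    exact (measure_mono inter_subset_right).trans_lt measure_ball_lt_top⟩
  have hu₁μ := hu₁.mono_measure hμle
  have hu₂μ := hu₂.mono_measure hμle
  have hG₁μ := hG₁.mono_measure hμle
  have hG₂μ := hG₂.mono_measure hμle
  obtain ⟨w₁, hw₁, hl₁, hl₁', ht₁⟩ := hT₁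
  obtain ⟨w₂, hw₂, hl₂, hl₂', ht₂⟩ := hT₂
  -- almost everywhere convergent subsequences
  obtain ⟨ns, hns, hae₁⟩ := (tendstoInMeasure_of_tendsto_eLpNorm hq0
    (fun k => (hw₁ k).continuous.aestronglyMeasurable) hu₁μ (hl₁ R)).exists_seq_tendsto_ae
  obtain ⟨ms, hms, hae₂⟩ := (tendstoInMeasure_of_tendsto_eLpNorm hq0
    (f := fun k => w₂ (ns k)) (fun k => (hw₂ _).continuous.aestronglyMeasurable) hu₂μ
    ((hl₂ R).comp hns.tendsto_atTop)).exists_seq_tendsto_ae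
  set s : ℕ → ℕ := fun k => ns (ms k) with hs
  have hst : Tendsto s atTop atTop := hns.tendsto_atTop.comp hms.tendsto_atTop
  have hae₁' : ∀ᵐ x ∂μ, Tendsto (fun k => w₁ (s k) x) atTop (𝓝 (u₁ x)) := by
    filter_upwards [hae₁] with x hx using hx.comp hms.tendsto_atTop
  have hsm := fun k => contDiff_testFun hβ hg (hw₁ (s k)) (hw₂ (s k))
  have hΨ := tendsto_eLpNorm_testFun_sub hq hβ hg
    (fun k => (hw₁ (s k)).continuous.aestronglyMeasurable)
    (fun k => (hw₂ (s k)).continuous.aestronglyMeasurable) hu₁μ hu₂μ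
    ((hl₁ R).comp hst) ((hl₂ R).comp hst)
  have hΨ' := tendsto_eLpNorm_testFunGrad_sub hq hq' hβ hg
    (fun k => (hw₁ (s k)).continuous.aestronglyMeasurable)
    (fun k => (hw₂ (s k)).continuous.aestronglyMeasurable)
    (fun k => (continuous_gradient (contDiff_one_of_infty (hw₁ (s k)))).aestronglyMeasurable)
    (fun k => (continuous_gradient (contDiff_one_of_infty (hw₂ (s k)))).aestronglyMeasurable)
    hG₁μ hG₂μ hae₁' hae₂ ((hl₁' R).comp hst) ((hl₂' R).comp hst)
  simp only [← gradient_testFun hβ hg (hw₁ _) (hw₂ _)] at hΨ'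
  have hwm : MemLp (testFun β g u₁ u₂) q μ :=
    MemLp.of_bound (aestronglyMeasurable_testFun hβ hg hu₁μ hu₂μ) (C * C)
      (ae_of_all _ fun x => norm_testFun_le hβ hg x)
  have hHm : MemLp (testFunGrad β g u₁ u₂ G₁ G₂) q μ :=
    memLp_testFunGrad hβ hg hu₁μ hu₂μ hG₁μ hG₂μ
  obtain ⟨hm, hm'⟩ := memLp_mul_and_gradient hwm hHm hχs hχD hχD'
  have hc := tendsto_eLpNorm_mul_sub hq hsm hwm.1 hχD hΨ
  have hc' := tendsto_eLpNorm_gradient_mul_sub hq hsm hwm.1 hHm.1 hχs hχD hχD' hΨ hΨ'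
  -- everything is supported in the ball
  have hχ0 : ∀ x ∉ Metric.ball (0 : Euc (n + 1)) R, χ x = 0 := fun x hx =>
    image_eq_zero_of_notMem_tsupport fun h => hx (hχR h)
  have hχ0' : ∀ x ∉ Metric.ball (0 : Euc (n + 1)) R, gradient χ x = 0 := fun x hx => by
    by_contra h
    exact hx (hχR (support_gradient_subset_tsupport _ h))
  have hs1 : Function.support (fun x => χ x * testFun β g u₁ u₂ x) ⊆ Metric.ball 0 R := by
    intro x hx
    by_contra h
    exact hx (by simp [hχ0 x h])
  have hs2 : Function.support (fun x => χ x • testFunGrad β g u₁ u₂ G₁ G₂ x +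
      testFun β g u₁ u₂ x • gradient χ x) ⊆ Metric.ball 0 R := by
    intro x hx
    by_contra h
    exact hx (by simp [hχ0 x h, hχ0' x h])
  have hmU := memLp_restrict_of_support_subset_ball hs1 hm
  have hmU' := memLp_restrict_of_support_subset_ball hs2 hm'
  have happ := smoothCompactApprox_of_trace_tendsto_zero hq hq' hΩ hΩb hΩl
    (f := fun k x => χ x * testFun β g (w₁ (s k)) (w₂ (s k)) x) (fun k => hχs.mul (hsm k))
    (fun k => χ.hasCompactSupport.mul_right) hmU hmU'
    (hc.congr fun k => (eLpNorm_restrict_eq_of_support_subset_ball (by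
      intro x hx
      by_contra h
      exact hx (by simp [hχ0 x h]))).symm)
    (hc'.congr fun k => (eLpNorm_restrict_eq_of_support_subset_ball (by
      intro x hx
      by_contra h
      refine hx ?_
      have : gradient (fun y => χ y * testFun β g (w₁ (s k)) (w₂ (s k)) y) x = 0 := by
        rw [gradient_mul ((contDiff_one_of_infty hχs).differentiable one_ne_zero x)
          ((contDiff_one_of_infty (hsm k)).differentiable one_ne_zero x), hχ0 x h, hχ0' x h]
        simp
      simp [this, hχ0 x h, hχ0' x h])).symm)
    (by
      refine tendsto_eLpNorm_zero_of_norm_le hq (C * C)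
        (fun k => (hw₁ (s k)).continuous.aestronglyMeasurable.sub hφ₁)
        (fun k => (hw₂ (s k)).continuous.aestronglyMeasurable.sub hφ₂)
        (ht₁.comp hst) (ht₂.comp hst) fun k => ?_
      -- Since `φ₁ - φ₂ ≤ 0 < ε`, `β(φ₁ - φ₂) = 0`, and the Lipschitz bound for `β` estimates the
      -- boundary values of the approximants by their trace errors.
      filter_upwards [hφ] with x hx
      have h1 := norm_sub_le_of_norm_deriv_le hβ.differentiable hβ.norm_deriv_le
        (w₁ (s k) x - w₂ (s k) x) (φ₁ x - φ₂ x)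
      rw [hβ0 (φ₁ x - φ₂ x) (by linarith), sub_zero] at h1
      have h2 : ‖w₁ (s k) x - w₂ (s k) x - (φ₁ x - φ₂ x)‖ ≤
          ‖w₁ (s k) x - φ₁ x‖ + ‖w₂ (s k) x - φ₂ x‖ := by
        rw [sub_sub_sub_comm]; exact norm_sub_le _ _
      have h3 := h1.trans (mul_le_mul_of_nonneg_left h2 hC)
      rw [norm_mul, testFun, norm_mul, Real.norm_of_nonneg χ.nonneg, Pi.sub_apply, Pi.sub_apply]
      have h4 := mul_le_mul h3 (hg.norm_le (w₁ (s k) x)) (norm_nonneg _) (by positivity)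
      refine (mul_le_of_le_one_left (by positivity) χ.le_one).trans (h4.trans_eq ?_)
      ring)
  -- removal of the cutoff
  have hfar : ∀ᵐ x ∂(volume.restrict (extDomain Ω)), R₀ < ‖x‖ →
      testFun β g u₁ u₂ x = 0 ∧ testFunGrad β g u₁ u₂ G₁ G₂ x = 0 := by
    filter_upwards [hR₁, hR₂] with x h1 h2 hx
    have a1 := abs_lt.1 (h1 (hR₀1.trans_lt hx))
    have a2 := abs_lt.1 (h2 (hR₀2.trans_lt hx))
    have hlt : u₁ x - u₂ x < ε := by linarith [a1.2, a2.1]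
    simp [testFun, testFunGrad, hβ0 _ hlt.le, deriv_eq_zero_of_eq_zero_of_le hβ0 hlt]
  have hnear : ∀ x : Euc (n + 1), ‖x‖ ≤ R₀ → χ x = 1 ∧ gradient χ x = 0 := by
    intro x hx
    have hball : x ∈ Metric.ball (0 : Euc (n + 1)) χ.rIn := by
      rw [mem_ball_zero_iff]; change ‖x‖ < R₀ + 1; linarith
    have := χ.eventuallyEq_one_of_mem_ball hball
    refine ⟨this.eq_of_nhds, ?_⟩
    rw [this.gradient_eq]
    exact gradient_const x 1
  have hew : (fun x => χ x * testFun β g u₁ u₂ x) =ᵐ[volume.restrict (extDomain Ω)]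
      testFun β g u₁ u₂ := by
    filter_upwards [hfar] with x hx
    rcases lt_or_ge R₀ ‖x‖ with h | h
    · rw [(hx h).1, mul_zero]
    · rw [(hnear x h).1, one_mul]
  have heH : (fun x => χ x • testFunGrad β g u₁ u₂ G₁ G₂ x + testFun β g u₁ u₂ x • gradient χ x)
      =ᵐ[volume.restrict (extDomain Ω)] testFunGrad β g u₁ u₂ G₁ G₂ := by
    filter_upwards [hfar] with x hx
    rcases lt_or_ge R₀ ‖x‖ with h | h
    · rw [(hx h).1, (hx h).2]; simp
    · rw [(hnear x h).1, (hnear x h).2]; simp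
  exact (happ.congr hew heH).memW1pZero hp (hmU.ae_eq hew) (hmU'.ae_eq heH)

/-! ### The subdifferential of `F` and monotonicity of the flux -/

section Subdifferential

variable {N : ℕ} {F : Seminorm ℝ (Euc N)}

/-- Euler's identity for a 1-homogeneous function: the subgradient inequality at `0` and at `2ξ`
gives the two bounds. -/
theorem inner_eq_of_mem_subdiff {z ξ : Euc N} (hz : z ∈ subdiff F ξ) : ⟪z, ξ⟫ = F ξ := by
  have h1 := hz 0
  have h2 := hz ((2 : ℝ) • ξ)
  rw [zero_sub, inner_neg_right, map_zero] at h1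
  rw [map_smul_eq_mul, Real.norm_two, inner_sub_right, inner_smul_right] at h2
  linarith

theorem inner_le_of_mem_subdiff {z ξ : Euc N} (hz : z ∈ subdiff F ξ) (η : Euc N) :
    ⟪z, η⟫ ≤ F η := by
  have h1 := hz η
  rw [inner_sub_right, inner_eq_of_mem_subdiff hz] at h1
  linarith

theorem abs_inner_le_of_mem_subdiff {z ξ : Euc N} (hz : z ∈ subdiff F ξ) (η : Euc N) :
    |⟪z, η⟫| ≤ F η := by
  refine abs_le.2 ⟨?_, inner_le_of_mem_subdiff hz η⟩
  have := inner_le_of_mem_subdiff hz (-η)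
  rw [inner_neg_right, map_neg_eq_map] at this
  linarith

/-- Monotonicity of `ξ ↦ F(ξ)^s ∂F(ξ)`, with the equality case. -/
theorem rpow_mul_inner_sub_nonneg {s : ℝ} (hs : 0 < s) {z₁ z₂ ξ₁ ξ₂ : Euc N}
    (h₁ : z₁ ∈ subdiff F ξ₁) (h₂ : z₂ ∈ subdiff F ξ₂) :
    0 ≤ F ξ₁ ^ s * ⟪z₁, ξ₁ - ξ₂⟫ - F ξ₂ ^ s * ⟪z₂, ξ₁ - ξ₂⟫ ∧
    (F ξ₁ ^ s * ⟪z₁, ξ₁ - ξ₂⟫ - F ξ₂ ^ s * ⟪z₂, ξ₁ - ξ₂⟫ = 0 →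
      F ξ₁ = F ξ₂ ∧ F ξ₁ ^ s * ⟪z₁, ξ₁ - ξ₂⟫ = 0) := by
  have e₁ := inner_eq_of_mem_subdiff h₁
  have e₂ := inner_eq_of_mem_subdiff h₂
  have l₁ := inner_le_of_mem_subdiff h₁ ξ₂
  have l₂ := inner_le_of_mem_subdiff h₂ ξ₁
  rw [inner_sub_right, inner_sub_right, e₁, e₂]
  set a := F ξ₁
  set b := F ξ₂
  have ha : 0 ≤ a := apply_nonneg F ξ₁
  have hb : 0 ≤ b := apply_nonneg F ξ₂
  -- After Euler's identity the expression equals `(a^s - b^s)(a - b) + a^s (b - ⟪z₁, ξ₂⟫) + b^s (a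
  -- - ⟪z₂, ξ₁⟫)`, a sum of three nonnegative terms. If it vanishes, so does each: the first gives
  -- `a = b`, and then the second is the claimed product.
  have m₁ := mul_nonneg (Real.rpow_nonneg ha s) (sub_nonneg.2 l₁)
  have m₂ := mul_nonneg (Real.rpow_nonneg hb s) (sub_nonneg.2 l₂)
  have hmono : a ≠ b → 0 < (a ^ s - b ^ s) * (a - b) := by
    intro hne
    rcases lt_or_gt_of_ne hne with h | h
    · exact mul_pos_of_neg_of_neg (sub_neg.2 (Real.rpow_lt_rpow ha h hs)) (sub_neg.2 h)
    · exact mul_pos (sub_pos.2 (Real.rpow_lt_rpow hb h hs)) (sub_pos.2 h)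
  have hmono0 : 0 ≤ (a ^ s - b ^ s) * (a - b) := by
    by_cases h : a = b
    · simp [h]
    · exact (hmono h).le
  refine ⟨by nlinarith, fun h0 => ?_⟩
  have hab : a = b := by
    by_contra hne
    have := hmono hne
    nlinarith
  rw [← hab] at h0 m₁ m₂ ⊢
  exact ⟨rfl, by nlinarith⟩

theorem seminorm_exists_le_mul_norm (F : Seminorm ℝ (Euc N)) :
    ∃ C : ℝ, 0 ≤ C ∧ ∀ x, F x ≤ C * ‖x‖ := by
  refine ⟨∑ i, F (EuclideanSpace.single i 1), Finset.sum_nonneg fun i _ => apply_nonneg F _,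
    fun x => ?_⟩
  have hx : x = ∑ i, x i • EuclideanSpace.single i (1 : ℝ) := by
    have := (EuclideanSpace.basisFun (Fin N) ℝ).sum_repr x
    simpa using this.symm
  have hsum : ∀ s : Finset (Fin N), F (∑ i ∈ s, x i • EuclideanSpace.single i (1 : ℝ)) ≤
      ∑ i ∈ s, ‖x i‖ * F (EuclideanSpace.single i 1) := fun s =>
    (Finset.le_sum_of_subadditive F (map_zero F).le (map_add_le_add F) s _).trans (Finset.sum_le_sum fun i _ => (map_smul_eq_mul F _ _).le)
  calc F x = F (∑ i, x i • EuclideanSpace.single i (1 : ℝ)) := congrArg F hx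
    _ ≤ ∑ i, ‖x i‖ * F (EuclideanSpace.single i 1) := hsum _
    _ ≤ ∑ i, F (EuclideanSpace.single i 1) * ‖x‖ := Finset.sum_le_sum fun i _ => by
        rw [mul_comm]
        exact mul_le_mul_of_nonneg_left (PiLp.norm_apply_le x i) (apply_nonneg F _)
    _ = _ := by rw [Finset.sum_mul]

theorem continuous_seminorm (F : Seminorm ℝ (Euc N)) : Continuous F := by
  obtain ⟨C, hC, h⟩ := seminorm_exists_le_mul_norm F
  refine (LipschitzWith.of_dist_le_mul (K := ⟨C, hC⟩) fun x y => ?_).continuous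
  rw [Real.dist_eq, dist_eq_norm]
  exact (abs_sub_map_le_sub F x y).trans (h _)

/-- The flux `F(G)^{p-1} z` paired with an `L^p` field is integrable. -/
theorem integrable_rpow_mul_inner {p : ℝ} (hp : 1 < p) {μ : Measure (Euc N)} {G z H : Euc N → Euc N}
    (hG : MemLp G (ENNReal.ofReal p) μ) (hH : MemLp H (ENNReal.ofReal p) μ)
    (hzm : AEStronglyMeasurable z μ) (hz : ∀ᵐ x ∂μ, z x ∈ subdiff F (G x)) :
    Integrable (fun x => F (G x) ^ (p - 1) * ⟪z x, H x⟫) μ := by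
  obtain ⟨C, hC, hFC⟩ := seminorm_exists_le_mul_norm F
  have hp0 : 0 < p := by linarith
  have hFm : ∀ {K : Euc N → Euc N}, MemLp K (ENNReal.ofReal p) μ →
      AEStronglyMeasurable (fun x => F (K x)) μ := fun hK =>
    (continuous_seminorm F).comp_aestronglyMeasurable hK.1
  have hFi : ∀ {K : Euc N → Euc N}, MemLp K (ENNReal.ofReal p) μ →
      Integrable (fun x => F (K x) ^ p) μ := by
    intro K hK
    have hL : MemLp (fun x => F (K x)) (ENNReal.ofReal p) μ :=
      hK.of_le_mul (c := C) (hFm hK) (ae_of_all _ fun x => by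
        rw [Real.norm_of_nonneg (apply_nonneg F _)]; exact hFC _)
    have := hL.integrable_norm_rpow (by simpa using hp0) ENNReal.ofReal_ne_top
    simpa only [Real.norm_of_nonneg (apply_nonneg F _), ENNReal.toReal_ofReal hp0.le] using this
  -- A crude Young inequality: `a^(p-1) b ≤ max(a, b)^p ≤ a^p + b^p`.
  refine ((hFi hG).add (hFi hH)).mono'
    (((hFm hG).aemeasurable.pow_const _).aestronglyMeasurable.mul (hzm.inner hH.1)) ?_
  filter_upwards [hz] with x hx
  have ha := apply_nonneg F (G x)
  have hb := apply_nonneg F (H x)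
  rw [norm_mul, Real.norm_of_nonneg (Real.rpow_nonneg ha _), Real.norm_eq_abs, Pi.add_apply]
  have hs : 0 ≤ p - 1 := by linarith
  have e : ∀ t : ℝ, 0 ≤ t → t ^ (p - 1) * t = t ^ p := fun t ht => by
    conv_rhs => rw [show p = (p - 1) + 1 by ring, Real.rpow_add_one' ht (by linarith)]
  refine (mul_le_mul_of_nonneg_left (abs_inner_le_of_mem_subdiff hx _)
    (Real.rpow_nonneg ha _)).trans ?_
  rcases le_total (F (G x)) (F (H x)) with h | h
  · calc _ ≤ F (H x) ^ (p - 1) * F (H x) :=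
          mul_le_mul_of_nonneg_right (Real.rpow_le_rpow ha h hs) hb
      _ ≤ _ := by rw [e _ hb]; exact le_add_of_nonneg_left (Real.rpow_nonneg ha _)
  · calc _ ≤ F (G x) ^ (p - 1) * F (G x) :=
          mul_le_mul_of_nonneg_left h (Real.rpow_nonneg ha _)
      _ ≤ _ := by rw [e _ ha]; exact le_add_of_nonneg_right (Real.rpow_nonneg hb _)

end Subdifferential

/-! ### The one-variable profiles -/

section TestProfiles

theorem SmoothBounded.mono {C D : ℝ} {β : ℝ → ℝ} (hβ : SmoothBounded C β) (h : C ≤ D) :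
    SmoothBounded D β :=
  ⟨hβ.contDiff, fun t => (hβ.norm_le t).trans h, fun t => (hβ.norm_deriv_le t).trans h⟩

theorem deriv_expNegInvGlue (x : ℝ) : deriv expNegInvGlue x = x⁻¹ ^ 2 * expNegInvGlue x := by
  have := (expNegInvGlue.hasDerivAt_polynomial_eval_inv_mul 1 x).deriv
  simpa using this

/-- With `s = 1 / (t - ε)` the derivative for `t > ε` is `s² exp(-s)`, at most `2` because `s² / 2 ≤
exp s`. -/
theorem smoothBounded_expNegInvGlue_sub (ε : ℝ) :
    SmoothBounded 2 (fun t => expNegInvGlue (t - ε)) := by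
  refine ⟨expNegInvGlue.contDiff.comp (contDiff_id.sub contDiff_const), fun t => ?_, fun t => ?_⟩
  · rw [Real.norm_of_nonneg (expNegInvGlue.nonneg _), expNegInvGlue]
    split_ifs with h
    · norm_num
    · have : 0 < (t - ε)⁻¹ := inv_pos.2 (not_le.1 h)
      have := Real.exp_le_one_iff.2 (neg_nonpos.2 this.le)
      linarith
  · rw [deriv_comp_sub_const, deriv_expNegInvGlue,
      Real.norm_of_nonneg (mul_nonneg (sq_nonneg _) (expNegInvGlue.nonneg _)), expNegInvGlue]
    split_ifs with h
    · norm_num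
    · have h0 : 0 < (t - ε)⁻¹ := inv_pos.2 (not_le.1 h)
      have h1 := Real.quadratic_le_exp_of_nonneg h0.le
      rw [Real.exp_neg, ← div_eq_mul_inv, div_le_iff₀ (Real.exp_pos _)]
      linarith

theorem deriv_expNegInvGlue_sub_pos {ε t : ℝ} (h : ε < t) :
    0 < deriv (fun t => expNegInvGlue (t - ε)) t := by
  rw [deriv_comp_sub_const, deriv_expNegInvGlue]
  have := expNegInvGlue.pos_of_pos (sub_pos.2 h)
  have : 0 < (t - ε)⁻¹ := inv_pos.2 (sub_pos.2 h)
  positivity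

theorem deriv_expNegInvGlue_sub_eq_zero {ε t : ℝ} (h : t ≤ ε) :
    deriv (fun t => expNegInvGlue (t - ε)) t = 0 := by
  rw [deriv_comp_sub_const, deriv_expNegInvGlue, expNegInvGlue.zero_of_nonpos (sub_nonpos.2 h),
    mul_zero]

theorem smoothBounded_one : SmoothBounded 4 (fun _ => 1) :=
  ⟨contDiff_const, fun t => by norm_num, fun t => by simp⟩

theorem deriv_arctan_add_two (t : ℝ) : deriv (fun t => Real.arctan t + 2) t = 1 / (1 + t ^ 2) :=
  ((Real.hasDerivAt_arctan t).add_const 2).deriv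

theorem arctan_add_two_pos (t : ℝ) : 0 < Real.arctan t + 2 := by
  have h1 := Real.neg_pi_div_two_lt_arctan t
  have h2 := Real.pi_lt_d2
  linarith

/-- The second test needs a factor that is bounded and positive with bounded, strictly positive
derivative. The identity would not do, since `u₁` may change sign and be unbounded; `2 > π / 2`
ensures positivity. -/
theorem smoothBounded_arctan_add_two : SmoothBounded 4 (fun t => Real.arctan t + 2) := by
  refine ⟨Real.contDiff_arctan.add contDiff_const, fun t => ?_, fun t => ?_⟩
  · rw [Real.norm_of_nonneg (arctan_add_two_pos t).le]
    have h1 := Real.arctan_lt_pi_div_two t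
    have h2 := Real.pi_lt_d2
    linarith
  · rw [deriv_arctan_add_two, Real.norm_of_nonneg (by positivity), div_le_iff₀ (by positivity)]
    nlinarith [sq_nonneg t]

end TestProfiles

/-! ### The comparison argument -/

/-- The comparison principle up to a positive margin. -/
theorem ae_sub_le_of_weak_sub_super {n : ℕ} {p : ℝ} (hp : 1 < p) (hpN : p < (n + 1 : ℕ))
    {Ω : Set (Euc (n + 1))} (hΩ : IsOpen Ω) (hΩb : Bornology.IsBounded Ω)
    (hΩl : HasLipschitzBoundary Ω) {F : Seminorm ℝ (Euc (n + 1))} (hF : ∀ ξ, F ξ = 0 → ξ = 0)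
    {φ₁ φ₂ u₁ u₂ : Euc (n + 1) → ℝ} (hφ₁ : AEStronglyMeasurable φ₁ (surfaceMeasure Ω))
    (hφ₂ : AEStronglyMeasurable φ₂ (surfaceMeasure Ω))
    (hφ : ∀ᵐ x ∂(surfaceMeasure Ω), φ₁ x ≤ φ₂ x)
    (hu₁ : IsWeakSubsolution F p Ω φ₁ u₁) (hu₂ : IsWeakSupersolution F p Ω φ₂ u₂)
    {ε : ℝ} (hε : 0 < ε) : ∀ᵐ x ∂(volume.restrict (extDomain Ω)), u₁ x - u₂ x ≤ ε := by
  obtain ⟨G₁, z₁, ad₁, sub⟩ := hu₁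
  obtain ⟨G₂, z₂, ad₂, sup⟩ := hu₂
  set β : ℝ → ℝ := fun t => expNegInvGlue (t - ε) with hβdef
  -- The bound is relaxed to `4` because both factors of a test function share one constant, and
  -- `arctan + 2` exceeds `2`.
  have hβ : SmoothBounded 4 β := (smoothBounded_expNegInvGlue_sub ε).mono (by norm_num)
  have hβ0 : ∀ t ≤ ε, β t = 0 := fun t ht => expNegInvGlue.zero_of_nonpos (sub_nonpos.2 ht)
  have hβpos : ∀ t, ε < t → 0 < β t := fun t ht => expNegInvGlue.pos_of_pos (sub_pos.2 ht)
  have hβnn : ∀ t, 0 ≤ β t := fun t => expNegInvGlue.nonneg _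
  have hβ'pos : ∀ t, ε < t → 0 < deriv β t := fun t ht => deriv_expNegInvGlue_sub_pos ht
  have hβ'0 : ∀ t ≤ ε, deriv β t = 0 := fun t ht => deriv_expNegInvGlue_sub_eq_zero ht
  have htest : ∀ {g : ℝ → ℝ}, SmoothBounded 4 g → MemW1pZero p (extDomain Ω)
      (testFun β g u₁ u₂) (testFunGrad β g u₁ u₂ G₁ G₂) := fun hg =>
    memW1pZero_testFun hp hΩ hΩb hΩl hφ₁ hφ₂ hφ ad₁.memLp.1 ad₂.memLp.1 ad₁.grad_memLp
      ad₂.grad_memLp ad₁.hasTrace ad₂.hasTrace ad₁.vanishes ad₂.vanishes hβ hg hε hβ0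
  have hs : 0 < p - 1 := by linarith
  -- testing with `β(u₁ - u₂)`
  have hone := htest smoothBounded_one
  have hgrad_one : ∀ x, testFunGrad β (fun _ => 1) u₁ u₂ G₁ G₂ x =
      deriv β (u₁ x - u₂ x) • (G₁ x - G₂ x) := fun x => by simp [testFunGrad]
  have hone_nn : ∀ᵐ x ∂(volume.restrict (extDomain Ω)), 0 ≤ testFun β (fun _ => 1) u₁ u₂ x :=
    ae_of_all _ fun x => mul_nonneg (hβnn _) zero_le_one
  have i₁ := sub _ _ hone hone_nn
  have i₂ := sup _ _ hone hone_nn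
  have int₁ := integrable_rpow_mul_inner hp ad₁.grad_memLp hone.grad_memLp ad₁.z_measurable ad₁.z_mem
  have int₂ := integrable_rpow_mul_inner hp ad₂.grad_memLp hone.grad_memLp ad₂.z_measurable ad₂.z_mem
  have hD : ∀ x, F (G₁ x) ^ (p - 1) * ⟪z₁ x, testFunGrad β (fun _ => 1) u₁ u₂ G₁ G₂ x⟫ -
      F (G₂ x) ^ (p - 1) * ⟪z₂ x, testFunGrad β (fun _ => 1) u₁ u₂ G₁ G₂ x⟫ =
      deriv β (u₁ x - u₂ x) * (F (G₁ x) ^ (p - 1) * ⟪z₁ x, G₁ x - G₂ x⟫ -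
        F (G₂ x) ^ (p - 1) * ⟪z₂ x, G₁ x - G₂ x⟫) := fun x => by
    rw [hgrad_one, inner_smul_right, inner_smul_right]; ring
  have hβ'nn : ∀ t, 0 ≤ deriv β t := fun t => by
    rcases le_or_gt t ε with h | h
    · exact (hβ'0 t h).ge
    · exact (hβ'pos t h).le
  have hD0 := (integral_eq_zero_iff_of_nonneg_ae (f := fun x =>
      F (G₁ x) ^ (p - 1) * ⟪z₁ x, testFunGrad β (fun _ => 1) u₁ u₂ G₁ G₂ x⟫ -
      F (G₂ x) ^ (p - 1) * ⟪z₂ x, testFunGrad β (fun _ => 1) u₁ u₂ G₁ G₂ x⟫) (by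
        filter_upwards [ad₁.z_mem, ad₂.z_mem] with x h₁ h₂
        rw [hD]
        exact mul_nonneg (hβ'nn _) (rpow_mul_inner_sub_nonneg hs h₁ h₂).1)
      -- The sub- and supersolution inequalities make the integral nonpositive, while monotonicity
      -- makes the integrand nonnegative.
      (int₁.sub int₂)).1 (le_antisymm (by rw [integral_sub int₁ int₂]; linarith)
      (integral_nonneg_of_ae (by
        filter_upwards [ad₁.z_mem, ad₂.z_mem] with x h₁ h₂
        rw [hD]
        exact mul_nonneg (hβ'nn _) (rpow_mul_inner_sub_nonneg hs h₁ h₂).1)))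
  have hkey : ∀ᵐ x ∂(volume.restrict (extDomain Ω)), ε < u₁ x - u₂ x →
      F (G₁ x) = F (G₂ x) ∧ F (G₁ x) ^ (p - 1) * ⟪z₁ x, G₁ x - G₂ x⟫ = 0 := by
    filter_upwards [hD0, ad₁.z_mem, ad₂.z_mem] with x hx h₁ h₂ hlt
    rw [hD, Pi.zero_apply] at hx
    exact (rpow_mul_inner_sub_nonneg hs h₁ h₂).2
      ((mul_eq_zero.1 hx).resolve_left (hβ'pos _ hlt).ne')
  -- testing the subsolution with `β(u₁ - u₂) (arctan u₁ + 2)`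
  have htwo := htest smoothBounded_arctan_add_two
  have i₃ := sub _ _ htwo (ae_of_all _ fun x => mul_nonneg (hβnn _) (arctan_add_two_pos _).le)
  have int₃ := integrable_rpow_mul_inner hp ad₁.grad_memLp htwo.grad_memLp ad₁.z_measurable ad₁.z_mem
  have hE : ∀ᵐ x ∂(volume.restrict (extDomain Ω)), F (G₁ x) ^ (p - 1) *
      ⟪z₁ x, testFunGrad β (fun t => Real.arctan t + 2) u₁ u₂ G₁ G₂ x⟫ =
      β (u₁ x - u₂ x) * (1 / (1 + u₁ x ^ 2)) * (F (G₁ x) ^ (p - 1) * F (G₁ x)) := by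
    filter_upwards [hkey, ad₁.z_mem] with x hx h₁
    rcases le_or_gt (u₁ x - u₂ x) ε with h | h
    · simp [testFunGrad, hβ0 _ h, hβ'0 _ h]
    · rw [testFunGrad, inner_add_right, inner_smul_right, inner_smul_right, deriv_arctan_add_two,
        inner_eq_of_mem_subdiff h₁]
      -- The part along `G₁ - G₂` vanishes by the equality case, leaving only the part where `g(u₁)`
      -- is differentiated.
      linear_combination (deriv β (u₁ x - u₂ x) * (Real.arctan (u₁ x) + 2)) * (hx h).2
  have hEnn : 0 ≤ᵐ[volume.restrict (extDomain Ω)] fun x => F (G₁ x) ^ (p - 1) *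
      ⟪z₁ x, testFunGrad β (fun t => Real.arctan t + 2) u₁ u₂ G₁ G₂ x⟫ := by
    filter_upwards [hE] with x hx
    have := apply_nonneg F (G₁ x)
    have := hβnn (u₁ x - u₂ x)
    rw [hx, Pi.zero_apply]
    positivity
  have hE0 := (integral_eq_zero_iff_of_nonneg_ae hEnn int₃).1
    (le_antisymm i₃ (integral_nonneg_of_ae hEnn))
  -- the gradient of `β(u₁ - u₂)` vanishes
  have hgrad0 : testFunGrad β (fun _ => 1) u₁ u₂ G₁ G₂ =ᵐ[volume.restrict (extDomain Ω)] 0 := by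
    filter_upwards [hkey, hE, hE0] with x hx h1 h2
    rw [hgrad_one, Pi.zero_apply]
    rcases le_or_gt (u₁ x - u₂ x) ε with h | h
    · rw [hβ'0 _ h, zero_smul]
    · rw [h2, Pi.zero_apply] at h1
      have hc : β (u₁ x - u₂ x) * (1 / (1 + u₁ x ^ 2)) ≠ 0 :=
        mul_ne_zero (hβpos _ h).ne' (by positivity)
      have hF1 : F (G₁ x) = 0 := by
        rcases mul_eq_zero.1 ((mul_eq_zero.1 h1.symm).resolve_left hc) with h3 | h3
        · exact (Real.rpow_eq_zero (apply_nonneg F _) hs.ne').1 h3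
        · exact h3
      -- Definiteness of `F` enters only here, applied to both gradients through `F (G₁ x) = F (G₂
      -- x) = 0`.
      rw [hF _ hF1, hF _ ((hx h).1.symm.trans hF1), sub_zero, smul_zero]
  filter_upwards [hone.ae_eq_zero_of_gradient_ae_eq_zero hp hpN hgrad0] with x hx
  by_contra hlt
  simp only [testFun, mul_one, Pi.zero_apply] at hx
  exact (hβpos _ (not_le.1 hlt)).ne' hx

end

theorem theorem4p5 {N : ℕ} {p : ℝ} (hp : 1 < p) (hpN : p < N)
    {Ω : Set (Euc N)} (hΩ_open : IsOpen Ω) (hΩ_bdd : Bornology.IsBounded Ω)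
    (hΩ_lip : HasLipschitzBoundary Ω)
    (F : Seminorm ℝ (Euc N)) (hF : ∀ ξ, F ξ = 0 → ξ = 0)
    {φ₁ φ₂ u₁ u₂ : Euc N → ℝ}
    (hφ₁ : MemTraceSpace p Ω φ₁) (hφ₂ : MemTraceSpace p Ω φ₂)
    (hφ : ∀ᵐ x ∂(surfaceMeasure Ω), φ₁ x ≤ φ₂ x)
    (hu₁ : IsWeakSubsolution F p Ω φ₁ u₁)
    (hu₂ : IsWeakSupersolution F p Ω φ₂ u₂) :
    ∀ᵐ x ∂(volume.restrict (extDomain Ω)), u₁ x ≤ u₂ x := by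
  obtain _ | n := N
  · norm_num at hpN; linarith
  -- Countably many margins allow the exceptional null sets to be united before letting the margin
  -- tend to zero.
  have h : ∀ k : ℕ, ∀ᵐ x ∂(volume.restrict (extDomain Ω)), u₁ x - u₂ x ≤ 1 / ((k : ℝ) + 1) :=
    fun k => ae_sub_le_of_weak_sub_super hp hpN hΩ_open hΩ_bdd hΩ_lip hF hφ₁.memLp.1
      hφ₂.memLp.1 hφ hu₁ hu₂ Nat.one_div_pos_of_nat
  filter_upwards [ae_all_iff.2 h] with x hx
  exact sub_nonpos.1 (ge_of_tendsto' tendsto_one_div_add_atTop_nhds_zero_nat hx)
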